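/- Let $n\ge 2$. For $y\in\mathbb R$ put $\mu_0(y)=\mathrm{diag}(e^{2iy},\dots,e^{2iy},e^{-2(n-1)iy})\in SU(n)$, let $\mu(A,B)=ABA^{-1}B^{-1}$ on $SU(n)\times SU(n)$, let $SU(n)_{\mu_0(y)}$ be the centralizer of $\mu_0(y)$ in $SU(n)$ and let $P(\mu_0(y))=\mu^{-1}(\mu_0(y))/SU(n)_{\mu_0(y)}$ be the quotient by simultaneous conjugation. Call $y$ admissible if $\mu_0(y)$ is not a scalar matrix and $SU(n)_{\mu_0(y)}$ modulo the centre of $SU(n)$ acts freely on $\mu^{-1}(\mu_0(y))$. Let $\mathcal A=\{\xi\in\mathbb R^n: \xi_1+\dots+\xi_n=\pi,\ \xi_i\ge 0\}$ and let $\mathcal A^{\rm reg}$ be its subset with all $\xi_i>0$. For $\xi\in\mathcal A$ let $\delta(\xi)=\mathrm{diag}(\delta_1,\dots,\delta_n)$ with $\delta_1=e^{\frac{2i}{n}\sum_{j=1}^n j\xi_j}$ and $\delta_{k+1}=e^{2i\xi_k}\delta_k$. Every $B\in SU(n)$ is similar to $\delta(\xi)$ for a unique $\xi=:\Xi(B)\in\mathcal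 A$; let $\hat\beta:P(\mu_0(y))\to\mathcal A$ be the map (the action map) induced by $(A,B)\mapsto\Xi(B)$. The set $\hat\beta^{-1}(\mathcal A^{\rm reg})$ is the domain of the torus action generated by $\hat\beta$. An admissible $y$ is of type (i) if $\hat\beta^{-1}(\mathcal A^{\rm reg})=P(\mu_0(y))$ (the torus action is global), and of type (ii) if $\hat\beta^{-1}(\mathcal A^{\rm reg})$ is a proper subset of $P(\mu_0(y))$. An open interval $(p,q)\subset[0,1]$ is of type (i) (resp. (ii)) if every $y$ with $y/\pi\in(p,q)$ is (admissible and) of type (i) (resp. (ii)). Let $\mathfrak F_n$ be the Farey sequence of order $n$: all fractions $0\le a/b\le 1$ with $\gcd(a,b)=1$ and $1\le b\le n$, in increasing order; consecutive elements are called neighbours. Then: 1. For $0\le y\le\pi$ the following are equivalent: $y$ is excluded, i.e. not admissible; $e^{2miy}=1$ for some $m\in\{1,\dots,n\}$; $y/\pi\in\mathfrak F_n$. 2. For every $\kappa$ coprime to $n$ with $1\le\kappa\le n-1$, $\kappa/n$ has a neighbour on each side in $\mathfrak F_n$, and the two open intervals between $\kappa/n$ and these neighbours are of type (i). 3. Every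 other open interval between neighbours in $\mathfrak F_n$ (i.e. neither endpoint is of the form $\kappa/n$ with $1\le\kappa\le n-1$, $\gcd(\kappa,n)=1$) is of type (ii). -/

import Mathlib

open scoped Matrix

noncomputable section

namespace CompactRS

/-- The group `SU(n)`. -/
abbrev SU (n : ℕ) : Type := Matrix.specialUnitaryGroup (Fin n) ℂ

/-- The `k`-th diagonal entry of `μ₀(y)`: it is `e^{2iy}` except for the last one,
which is `e^{-2(n-1)iy}`. -/
def muZeroEntry (n : ℕ) (y : ℝ) (k : Fin n) : ℂ :=
  if (k : ℕ) + 1 = n then Complex.exp (-2 * ((n : ℂ) - 1) * Complex.I * (y : ℂ))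
  else Complex.exp (2 * Complex.I * (y : ℂ))

theorem muZero_mem (n : ℕ) (y : ℝ) :
    Matrix.diagonal (muZeroEntry n y) ∈ Matrix.specialUnitaryGroup (Fin n) ℂ := by
  rw [Matrix.mem_specialUnitaryGroup_iff]
  constructor
  · rw [Matrix.mem_unitaryGroup_iff, Matrix.star_eq_conjTranspose,
      Matrix.diagonal_conjTranspose, Matrix.diagonal_mul_diagonal, ← Matrix.diagonal_one]
    congr 1
    funext k
    have key : ∀ z : ℂ, star z = -z → Complex.exp z * star (Complex.exp z) = 1 := by
      intro z hz
      have h : star (Complex.exp z) = Complex.exp (star z) := (Complex.exp_conj z).symm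
      rw [h, hz, ← Complex.exp_add, add_neg_cancel, Complex.exp_zero]
    simp only [Pi.star_apply, muZeroEntry]
    split_ifs
    · apply key
      simp
    · apply key
      simp
  · rw [Matrix.det_diagonal]
    cases n with
    | zero => simp
    | succ m =>
      rw [Fin.prod_univ_castSucc]
      have h1 : ∀ k : Fin m, muZeroEntry (m + 1) y k.castSucc
          = Complex.exp (2 * Complex.I * (y : ℂ)) := by
        intro k
        have hk : ((k.castSucc : Fin (m + 1)) : ℕ) + 1 ≠ m + 1 := by
          have := k.isLt
          simp only [Fin.val_castSucc]
          omega
        simp only [muZeroEntry, if_neg hk]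
      have h2 : muZeroEntry (m + 1) y (Fin.last m)
          = Complex.exp (-2 * (m : ℂ) * Complex.I * (y : ℂ)) := by
        simp [muZeroEntry]
      rw [Finset.prod_congr rfl (fun k _ => h1 k), h2, Finset.prod_const, Finset.card_univ,
        Fintype.card_fin, ← Complex.exp_nat_mul, ← Complex.exp_add]
      have : (m : ℂ) * (2 * Complex.I * (y : ℂ)) + -2 * (m : ℂ) * Complex.I * (y : ℂ) = 0 := by
        ring
      rw [this, Complex.exp_zero]

/-- `μ₀(y) = diag(e^{2iy}, …, e^{2iy}, e^{-2(n-1)iy})` as an element of `SU(n)`. -/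
def muZero (n : ℕ) (y : ℝ) : SU n := ⟨Matrix.diagonal (muZeroEntry n y), muZero_mem n y⟩

/-- The group commutator map `μ : SU(n) × SU(n) → SU(n)`, `μ(A, B) = A B A⁻¹ B⁻¹`. -/
def commMap (n : ℕ) (p : SU n × SU n) : SU n := p.1 * p.2 * p.1⁻¹ * p.2⁻¹

/-- Diagonal conjugation `η · (A, B) = (η A η⁻¹, η B η⁻¹)`. -/
def conjPair {n : ℕ} (η : SU n) (p : SU n × SU n) : SU n × SU n :=
  (η * p.1 * η⁻¹, η * p.2 * η⁻¹)

/-- The isotropy group of `g ∈ SU(n)` with respect to conjugation. -/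
def isotropy {n : ℕ} (g : SU n) : Subgroup (SU n) := Subgroup.centralizer {g}

/-- `g` is a strongly regular value of the commutator map: the isotropy group of `g` modulo
the centre of `SU(n)` acts freely on the fibre over `g`. -/
def StronglyRegular {n : ℕ} (g : SU n) : Prop :=
  ∀ p : SU n × SU n, commMap n p = g →
    ∀ η ∈ isotropy g, conjPair η p = p → η ∈ Subgroup.center (SU n)

/-- `y` is admissible: `μ₀(y)` is strongly regular and not a multiple of the unit matrix. -/
def IsAdmissible (n : ℕ) (y : ℝ) : Prop :=
  StronglyRegular (muZero n y) ∧
    ¬ ∃ c : ℂ, (muZero n y : Matrix (Fin n) (Fin n) ℂ) = c • (1 : Matrix (Fin n) (Fin n) ℂ)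

/-- The fibre `μ⁻¹(μ₀(y))`. -/
abbrev Fibre (n : ℕ) (y : ℝ) : Type := {p : SU n × SU n // commMap n p = muZero n y}

/-- The orbit relation of the isotropy group of `μ₀(y)` on the fibre `μ⁻¹(μ₀(y))`. -/
def orbitSetoid (n : ℕ) (y : ℝ) : Setoid (Fibre n y) where
  r p q := ∃ η ∈ isotropy (muZero n y), conjPair η p.1 = q.1
  iseqv :=
    { refl := fun p => ⟨1, Subgroup.one_mem _, by simp [conjPair]⟩
      symm := by
        rintro p q ⟨η, hη, h⟩
        refine ⟨η⁻¹, Subgroup.inv_mem _ hη, ?_⟩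
        rw [← h]
        simp [conjPair, mul_assoc]
      trans := by
        rintro p q r ⟨η, hη, h⟩ ⟨ζ, hζ, h'⟩
        refine ⟨ζ * η, Subgroup.mul_mem _ hζ hη, ?_⟩
        rw [← h', ← h]
        simp [conjPair, mul_assoc] }

/-- The reduced phase space `P(μ₀(y)) = μ⁻¹(μ₀(y)) / SU(n)_{μ₀(y)}`. -/
abbrev ReducedSpace (n : ℕ) (y : ℝ) : Type := Quotient (orbitSetoid n y)

/-- The simplex `𝒜` of all `ξ` with `ξ₁ + ⋯ + ξₙ = π` and `ξᵢ ≥ 0`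
(`ξ i` in the code is `ξ_{i+1}`). -/
def alcove (n : ℕ) : Set (Fin n → ℝ) := {ξ | ∑ i, ξ i = Real.pi ∧ ∀ i, 0 ≤ ξ i}

/-- The interior `𝒜^reg` of the simplex `𝒜` in its hyperplane. -/
def alcoveReg (n : ℕ) : Set (Fin n → ℝ) := {ξ | ∑ i, ξ i = Real.pi ∧ ∀ i, 0 < ξ i}

/-- The diagonal matrix `δ(ξ)` with `δ₁(ξ) = exp((2i/n) ∑ⱼ j ξⱼ)` and
`δ_{k+1}(ξ) = e^{2i ξ_k} δ_k(ξ)`. -/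
def delta (n : ℕ) (ξ : Fin n → ℝ) : Matrix (Fin n) (Fin n) ℂ :=
  Matrix.diagonal fun k =>
    Complex.exp (2 * Complex.I *
      (((∑ j : Fin n, ((j : ℝ) + 1) * ξ j) / (n : ℝ) + ∑ j ∈ Finset.Iio k, ξ j : ℝ) : ℂ))

/-- The map `Ξ : SU(n) → 𝒜`: `Ξ(g)` is the (unique) `ξ ∈ 𝒜` for which `g` is similar
to `δ(ξ)`. -/
def Xi {n : ℕ} (g : SU n) : Fin n → ℝ :=
  Classical.epsilon fun ξ => ξ ∈ alcove n ∧ IsConj (g : Matrix (Fin n) (Fin n) ℂ) (delta n ξ)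

theorem Xi_conj {n : ℕ} (η g : SU n) : Xi (η * g * η⁻¹) = Xi g := by
  have hconj : IsConj (g : Matrix (Fin n) (Fin n) ℂ)
      ((η * g * η⁻¹ : SU n) : Matrix (Fin n) (Fin n) ℂ) := by
    have h : IsConj g (η * g * η⁻¹) := isConj_iff.2 ⟨η, rfl⟩
    exact MonoidHom.map_isConj (Matrix.specialUnitaryGroup (Fin n) ℂ).subtype h
  unfold Xi
  congr 1
  funext ξ
  exact propext (and_congr_right fun _ => ⟨fun h => hconj.trans h, fun h => hconj.symm.trans h⟩)

/-- The action map `β̂ : P(μ₀(y)) → 𝒜`, induced by `(A, B) ↦ Ξ(B)`. -/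
def actionMap (n : ℕ) (y : ℝ) : ReducedSpace n y → (Fin n → ℝ) :=
  Quotient.lift (fun p : Fibre n y => Xi p.1.2) (by
    rintro p q ⟨η, -, h⟩
    rw [← h]
    exact (Xi_conj η p.1.2).symm)

/-- The domain `β̂⁻¹(𝒜^reg)` of the torus action on `P(μ₀(y))` generated by `β̂`. -/
def torusDomain (n : ℕ) (y : ℝ) : Set (ReducedSpace n y) := actionMap n y ⁻¹' alcoveReg n

/-- Type (i): `y` is admissible and the torus action is defined on the whole of `P(μ₀(y))`. -/
def IsTypeI (n : ℕ) (y : ℝ) : Prop := IsAdmissible n y ∧ torusDomain n y = Set.univ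

/-- Type (ii): `y` is admissible and the domain of the torus action is a proper subset
of `P(μ₀(y))`. -/
def IsTypeII (n : ℕ) (y : ℝ) : Prop := IsAdmissible n y ∧ torusDomain n y ≠ Set.univ

/-- The Farey sequence of order `n`, as a set of real numbers: all `0 ≤ a/b ≤ 1` in lowest
terms with `b ≤ n`. -/
def farey (n : ℕ) : Set ℝ :=
  {x | ∃ a b : ℕ, 0 < b ∧ b ≤ n ∧ a ≤ b ∧ Nat.Coprime a b ∧ x = (a : ℝ) / (b : ℝ)}

/-- `p < q` are consecutive elements of the Farey sequence of order `n`. -/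
def FareyNeighbours (n : ℕ) (p q : ℝ) : Prop :=
  p ∈ farey n ∧ q ∈ farey n ∧ p < q ∧ ∀ x ∈ farey n, ¬ (p < x ∧ x < q)

/-- The open interval `(p, q)` of values of `y/π` consists entirely of type (i) values. -/
def IntervalTypeI (n : ℕ) (p q : ℝ) : Prop :=
  ∀ y : ℝ, y / Real.pi ∈ Set.Ioo p q → IsTypeI n y

/-- The open interval `(p, q)` of values of `y/π` consists entirely of type (ii) values. -/
def IntervalTypeII (n : ℕ) (p q : ℝ) : Prop :=
  ∀ y : ℝ, y / Real.pi ∈ Set.Ioo p q → IsTypeII n y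

/-- `x = κ/n` for some `1 ≤ κ ≤ n - 1` coprime to `n`. -/
def IsSpecial (n : ℕ) (x : ℝ) : Prop :=
  ∃ κ : ℕ, 1 ≤ κ ∧ κ < n ∧ Nat.Coprime κ n ∧ x = (κ : ℝ) / (n : ℝ)

end CompactRS

end

/-! Put q = e^{2iy}. List the half-angles of the eigenvalues of B in increasing order and extend
them by θ_{j+n} = θ_j + π; the coordinates of ξ are the gaps θ_{j+1} - θ_j, so the torus action is
global exactly when no B in the fibre has a repeated eigenvalue. A pair lies in the fibre iff ABA⁻¹
= μ₀(y)B. Thus μ₀(y)B is isospectral to B, while it agrees with qB on a hyperplane.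

Excluded values. If a non-scalar η fixes a pair, the range of η - λ for a suitable eigenvalue λ is
invariant under A and B and satisfies AB = qBA there, so determinants give q^dim = 1. Conversely, if
q^m = 1 with m < n, two cyclic shifts of lengths m and n - m form a reducible pair; if q^n = 1,
μ₀(y) is scalar.

Type (i). Agreement on a hyperplane forces the spectra of B and qB to interlace (`interlacing`): for
fixed κ, the differences θ_{j+κ} - θ_j cannot be below y for one j and above y for another. Their
average over a period is κπ/n, so all are ≥ y when y < κπ/n and all are ≤ y when y > κπ/n. If sκ = 1
+ ln, iterating s times gives the gap bound θ_{j+1} - θ_j ≥ sy - lπ, which is positive precisely to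
the right of l/s, the left neighbour of κ/n. The right side is symmetric.

Type (ii). If a/b and c/d are neighbours with b, d < n, put k = b + d - n. The spectrum consisting
of the strings 1, ..., q^{b-1} and q^k, ..., q^{d-1} has n members and a repetition. Multiplication
by q trades 1, q^k for q^b, q^d, and a rank one perturbation supported at the two string ends trades
them back. Its squared weights are nonnegative because 1, q^b, q^k, q^d occur in this cyclic order
(`exists_weight`), which is where the Farey property enters (`exists_int_angle`). -/

noncomputable section

namespace CompactRS

open Matrix Polynomial

variable {n : ℕ}

/-! ### Diagonalization of unitary matrices and conjugacy under SU(n) -/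

/-- Avoiding finitely many points on the unit circle. -/
theorem exists_unit_eval_ne_zero {p : ℂ[X]} (hp : p ≠ 0) :
    ∃ c : ℂ, c * star c = 1 ∧ p.eval c ≠ 0 := by
  by_contra! h
  refine hp (Polynomial.eq_zero_of_infinite_isRoot p ?_)
  obtain ⟨r, hr0, hr1, hrinj⟩ : ∃ r : ℕ → ℝ, (∀ t, 0 < r t) ∧ (∀ t, r t ≤ 1) ∧
      Function.Injective r := by
    refine ⟨fun t => ((t : ℝ) + 1)⁻¹, fun t => by positivity, fun t => ?_, fun s t hst => ?_⟩
    · exact inv_le_one_of_one_le₀ (by linarith [Nat.cast_nonneg (α := ℝ) t])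
    · simpa using hst
  have hinj : Function.Injective fun t : ℕ => Complex.exp (Complex.I * (r t : ℂ)) := by
    intro s t hst
    simp only [Complex.exp_eq_exp_iff_exists_int] at hst
    obtain ⟨k, hk⟩ := hst
    have hk' : r s = r t + k * (2 * Real.pi) := by
      have := congrArg Complex.im hk
      simpa using this
    have hpi := Real.pi_gt_three
    have hk0 : k = 0 := by
      have h1 : (k : ℝ) < 1 := by nlinarith [hr0 t, hr1 s]
      have h2 : (-1 : ℝ) < k := by nlinarith [hr0 s, hr1 t]
      have h1' : k < 1 := by exact_mod_cast h1
      have h2' : -1 < k := by exact_mod_cast h2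
      omega
    exact hrinj (by rw [hk', hk0]; simp)
  refine (Set.infinite_range_of_injective hinj).mono ?_
  rintro _ ⟨t, rfl⟩
  refine h _ ?_
  have h1 : star (Complex.exp (Complex.I * (r t : ℂ)))
      = Complex.exp (-(Complex.I * (r t : ℂ))) := by
    rw [show ∀ z : ℂ, star (Complex.exp z) = Complex.exp (star z) from
      fun z => (Complex.exp_conj z).symm]
    simp only [star_mul', Complex.star_def, Complex.conj_I, Complex.conj_ofReal]
    ring_nf
  rw [h1, ← Complex.exp_add, add_neg_cancel, Complex.exp_zero]

/-- The spectral theorem for unitary matrices, through the Cayley transform. -/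
theorem unitary_diagonalization {U : Matrix (Fin n) (Fin n) ℂ} (hU : U * Uᴴ = 1) :
    ∃ (P : Matrix (Fin n) (Fin n) ℂ) (d : Fin n → ℂ),
      P * Pᴴ = 1 ∧ Pᴴ * P = 1 ∧ U = P * diagonal d * Pᴴ := by
  have hU' : Uᴴ * U = 1 := mul_eq_one_comm.1 hU
  -- A unimodular c with c + U invertible makes the Cayley transform H = i(c - U)(c + U)⁻¹
  -- available; unitarity of U makes H Hermitian.
  obtain ⟨c, hc, hdet⟩ := exists_unit_eval_ne_zero ((-U).charpoly_monic.ne_zero)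
  rw [eval_charpoly] at hdet
  have hc' : star c * c = 1 := by rw [mul_comm]; exact hc
  set K : Matrix (Fin n) (Fin n) ℂ := scalar (Fin n) c - -U with hK
  have hKu : IsUnit K.det := isUnit_iff_ne_zero.2 hdet
  have hKs : K = c • (1 : Matrix (Fin n) (Fin n) ℂ) + U := by
    rw [hK, sub_neg_eq_add, scalar_apply, smul_one_eq_diagonal]
  set L : Matrix (Fin n) (Fin n) ℂ := c • (1 : Matrix (Fin n) (Fin n) ℂ) - U with hL
  have hKH : Kᴴ = star c • (1 : Matrix (Fin n) (Fin n) ℂ) + Uᴴ := by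
    rw [hKs]; simp [conjTranspose_add, conjTranspose_smul]
  have hLH : Lᴴ = star c • (1 : Matrix (Fin n) (Fin n) ℂ) - Uᴴ := by
    rw [hL]; simp [conjTranspose_sub, conjTranspose_smul]
  have key : Kᴴ * L = -(Lᴴ * K) := by
    rw [hKH, hLH, hL, hKs]
    simp only [add_mul, sub_mul, mul_add, mul_sub, smul_mul_assoc, mul_smul_comm, one_mul,
      mul_one, hU', smul_add, smul_sub]
    rw [smul_smul, hc]
    module
  set H : Matrix (Fin n) (Fin n) ℂ := Complex.I • (L * K⁻¹) with hHdef
  have hHerm : H.IsHermitian := by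
    have hKHu : IsUnit Kᴴ.det := by rw [det_conjTranspose]; exact hKu.star
    have h1 : Hᴴ = (-Complex.I) • (Kᴴ⁻¹ * Lᴴ) := by
      rw [hHdef, conjTranspose_smul, conjTranspose_mul, conjTranspose_nonsing_inv]
      simp
    rw [Matrix.IsHermitian, h1]
    have h2 : Kᴴ⁻¹ * Lᴴ = -(L * K⁻¹) := by
      have h3 : Kᴴ⁻¹ * (Kᴴ * L) * K⁻¹ = -(Kᴴ⁻¹ * (Lᴴ * K) * K⁻¹) := by
        rw [key]; simp
      rw [← mul_assoc, nonsing_inv_mul _ hKHu, one_mul, mul_assoc Kᴴ⁻¹, mul_assoc Lᴴ,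
        mul_nonsing_inv _ hKu, mul_one] at h3
      rw [h3, neg_neg]
    rw [h2, hHdef]; simp
  have hHK : H * K = Complex.I • L := by
    rw [hHdef, smul_mul_assoc, mul_assoc, nonsing_inv_mul _ hKu, mul_one]
  set P : Matrix (Fin n) (Fin n) ℂ := (hHerm.eigenvectorUnitary : Matrix (Fin n) (Fin n) ℂ)
    with hP
  set Λ : Fin n → ℂ := RCLike.ofReal ∘ hHerm.eigenvalues with hΛ
  have hPP : P * Pᴴ = 1 := (mem_unitaryGroup_iff.1 hHerm.eigenvectorUnitary.2)
  have hPP' : Pᴴ * P = 1 := mul_eq_one_comm.1 hPP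
  have hspec : H = P * diagonal Λ * Pᴴ := by
    have := hHerm.spectral_theorem
    rw [Unitary.conjStarAlgAut_apply] at this
    exact this
  -- The eigenvalues of H are real, so the inverse Cayley transform can be applied entrywise.
  have hne : ∀ i, Λ i + Complex.I ≠ 0 := by
    intro i hi
    have := congrArg Complex.im hi
    simp [hΛ] at this
  have hUeq : (H + Complex.I • 1) * U = (-c) • (H - Complex.I • 1) := by
    have h4 : H * (c • (1 : Matrix (Fin n) (Fin n) ℂ) + U)
        = Complex.I • (c • (1 : Matrix (Fin n) (Fin n) ℂ) - U) := by rw [← hKs, hHK, hL]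
    simp only [mul_add, mul_smul_comm, mul_one, smul_sub] at h4
    have h5 : H * U = Complex.I • c • (1 : Matrix (Fin n) (Fin n) ℂ) - Complex.I • U - c • H := by
      rw [← h4]; abel
    rw [add_mul, h5, smul_mul_assoc, one_mul]
    module
  set W := Pᴴ * U * P with hW
  have hdiag : diagonal (fun i => Λ i + Complex.I) * W
      = diagonal fun i => (-c) * (Λ i - Complex.I) := by
    have h6 : diagonal (fun i => Λ i + Complex.I) = Pᴴ * (H + Complex.I • 1) * P := by
      rw [hspec, mul_add, add_mul]
      have e1 : Pᴴ * (P * diagonal Λ * Pᴴ) * P = (Pᴴ * P) * diagonal Λ * (Pᴴ * P) := by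
        simp only [mul_assoc]
      rw [e1, hPP']
      simp only [mul_smul_comm, smul_mul_assoc, mul_one, hPP', one_mul]
      rw [smul_one_eq_diagonal, diagonal_add]
    have h7 : (diagonal fun i => (-c) * (Λ i - Complex.I))
        = Pᴴ * ((-c) • (H - Complex.I • 1)) * P := by
      rw [hspec, mul_smul_comm, smul_mul_assoc, mul_sub, sub_mul]
      have e1 : Pᴴ * (P * diagonal Λ * Pᴴ) * P = (Pᴴ * P) * diagonal Λ * (Pᴴ * P) := by
        simp only [mul_assoc]
      rw [e1, hPP']
      simp only [mul_smul_comm, smul_mul_assoc, mul_one, hPP', one_mul]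
      rw [smul_one_eq_diagonal, diagonal_sub, ← diagonal_smul]
      rfl
    rw [h6, h7, ← hUeq, hW]
    calc Pᴴ * (H + Complex.I • 1) * P * (Pᴴ * U * P)
        = Pᴴ * (H + Complex.I • 1) * (P * Pᴴ) * U * P := by simp only [mul_assoc]
      _ = _ := by rw [hPP, mul_one]; simp only [mul_assoc]
  refine ⟨P, fun i => (Λ i + Complex.I)⁻¹ * ((-c) * (Λ i - Complex.I)), hPP, hPP', ?_⟩
  have hWd : W = diagonal fun i => (Λ i + Complex.I)⁻¹ * ((-c) * (Λ i - Complex.I)) := by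
    rw [← diagonal_mul_diagonal, ← hdiag, ← mul_assoc, diagonal_mul_diagonal]
    have : (fun i => (Λ i + Complex.I)⁻¹ * (Λ i + Complex.I)) = fun _ => 1 := by
      funext i; exact inv_mul_cancel₀ (hne i)
    rw [this, diagonal_one, one_mul]
  rw [← hWd, hW]
  calc U = (P * Pᴴ) * U * (P * Pᴴ) := by rw [hPP, one_mul, mul_one]
    _ = _ := by simp only [mul_assoc]

/-- Root multiplicities show that d and e have fibres of equal size over every z; bijections between
the fibres glue to a permutation. -/
theorem exists_perm_of_charpoly_eq {ι : Type*} [Fintype ι] [DecidableEq ι] {d e : ι → ℂ}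
    (h : (diagonal d).charpoly = (diagonal e).charpoly) : ∃ σ : Equiv.Perm ι, d ∘ σ = e := by
  have hm : Multiset.map d Finset.univ.val = Multiset.map e Finset.univ.val := by
    have := congrArg Polynomial.roots h
    simpa [charpoly_diagonal, Polynomial.roots_prod_X_sub_C, Polynomial.roots_prod,
      Finset.prod_ne_zero_iff, Polynomial.X_sub_C_ne_zero] using this
  have hcard : ∀ z : ℂ, Fintype.card {i // e i = z} = Fintype.card {i // d i = z} := by
    intro z
    have := congrArg (Multiset.count z) hm
    simp only [Multiset.count_map] at this
    rw [Fintype.card_subtype, Fintype.card_subtype, Finset.card, Finset.card]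
    simp only [Finset.filter_val, eq_comm (b := z)]
    exact this.symm
  refine ⟨(Equiv.sigmaFiberEquiv e).symm.trans ((Equiv.sigmaCongrRight fun z =>
    Fintype.equivOfCardEq (hcard z)).trans (Equiv.sigmaFiberEquiv d)), ?_⟩
  funext i
  simp only [Function.comp_apply, Equiv.trans_apply]
  exact (Fintype.equivOfCardEq (hcard (e i)) ⟨i, rfl⟩).2

theorem charpoly_conj {P X Y : Matrix (Fin n) (Fin n) ℂ} (h : Y * P = 1) :
    (P * X * Y).charpoly = X.charpoly := by
  rw [charpoly_mul_comm, ← mul_assoc, h, one_mul]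

/-- A unitary matrix is unitarily diagonalizable with its eigenvalues in any prescribed order. -/
theorem unitary_diagonalization_of_charpoly {U : Matrix (Fin n) (Fin n) ℂ} (hU : U * Uᴴ = 1)
    {d : Fin n → ℂ} (h : U.charpoly = (diagonal d).charpoly) :
    ∃ P : Matrix (Fin n) (Fin n) ℂ, P * Pᴴ = 1 ∧ Pᴴ * P = 1 ∧ U = P * diagonal d * Pᴴ := by
  obtain ⟨Q, e, hQ, hQ', rfl⟩ := unitary_diagonalization hU
  rw [charpoly_conj hQ'] at h
  obtain ⟨σ, hσ⟩ := exists_perm_of_charpoly_eq h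
  set R : Matrix (Fin n) (Fin n) ℂ := (1 : Matrix (Fin n) (Fin n) ℂ).submatrix id σ with hR
  have hRR : R * Rᴴ = 1 := by
    rw [hR, conjTranspose_submatrix, submatrix_mul_equiv]
    simp
  have hRd : R * diagonal d * Rᴴ = diagonal e := by
    have : diagonal d = (diagonal e).submatrix σ σ := by
      rw [submatrix_diagonal _ _ σ.injective, hσ]
    rw [this, hR, conjTranspose_submatrix, submatrix_mul_equiv, submatrix_mul_equiv]
    simp
  refine ⟨Q * R, ?_, ?_, ?_⟩
  · rw [conjTranspose_mul]
    calc Q * R * (Rᴴ * Qᴴ) = Q * (R * Rᴴ) * Qᴴ := by simp only [mul_assoc]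
      _ = 1 := by rw [hRR, mul_one, hQ]
  · rw [conjTranspose_mul]
    calc Rᴴ * Qᴴ * (Q * R) = Rᴴ * (Qᴴ * Q) * R := by simp only [mul_assoc]
      _ = 1 := by rw [hQ', mul_one, mul_eq_one_comm.1 hRR]
  · rw [conjTranspose_mul, ← hRd]
    simp only [mul_assoc]

/-- Every unitary matrix is a unit scalar multiple of an element of `SU(n)`. -/
theorem exists_smul_mem_SU (hn : n ≠ 0) {P : Matrix (Fin n) (Fin n) ℂ} (hP : P * Pᴴ = 1) :
    ∃ c : ℂ, c * star c = 1 ∧ c • P ∈ specialUnitaryGroup (Fin n) ℂ := by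
  have hdet : P.det * star P.det = 1 := by
    have := congrArg det hP
    rwa [det_mul, det_conjTranspose, det_one] at this
  obtain ⟨w, hw⟩ := IsAlgClosed.exists_pow_nat_eq (star P.det) (Nat.pos_of_ne_zero hn)
  have hnorm : ‖w‖ = 1 := by
    have h1 : ‖P.det‖ = 1 := by
      have := congrArg norm hdet
      rw [norm_mul, norm_star, norm_one] at this
      nlinarith [norm_nonneg P.det]
    have := congrArg norm hw
    rw [norm_pow, norm_star, h1] at this
    exact (pow_eq_one_iff_of_nonneg (norm_nonneg w) hn).1 this
  have hw1 : w * star w = 1 := by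
    rw [Complex.star_def, Complex.mul_conj, Complex.normSq_eq_norm_sq, hnorm]; simp
  refine ⟨w, hw1, ?_⟩
  rw [mem_specialUnitaryGroup_iff, mem_unitaryGroup_iff, star_eq_conjTranspose,
    conjTranspose_smul, smul_mul_smul_comm, hw1, hP, one_smul]
  refine ⟨rfl, ?_⟩
  rw [det_smul, Fintype.card_fin, hw, mul_comm]
  exact hdet

/-- Unitary matrices with the same characteristic polynomial are conjugate under `SU(n)`. -/
theorem exists_SU_conj (hn : n ≠ 0) {U V : Matrix (Fin n) (Fin n) ℂ} (hU : U * Uᴴ = 1)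
    (hV : V * Vᴴ = 1) (h : U.charpoly = V.charpoly) :
    ∃ g : SU n, (g : Matrix (Fin n) (Fin n) ℂ) * U = V * g := by
  obtain ⟨Q, d, hQ, hQ', rfl⟩ := unitary_diagonalization hU
  rw [charpoly_conj hQ'] at h
  obtain ⟨P, hP, hP', rfl⟩ := unitary_diagonalization_of_charpoly hV h.symm
  have hPQ : (P * Qᴴ) * (P * Qᴴ)ᴴ = 1 := by
    rw [conjTranspose_mul, conjTranspose_conjTranspose]
    calc P * Qᴴ * (Q * Pᴴ) = P * (Qᴴ * Q) * Pᴴ := by simp only [mul_assoc]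
      _ = 1 := by rw [hQ', mul_one, hP]
  obtain ⟨c, -, hc⟩ := exists_smul_mem_SU hn hPQ
  refine ⟨⟨_, hc⟩, ?_⟩
  simp only [smul_mul_assoc, mul_smul_comm]
  congr 1
  calc P * Qᴴ * (Q * diagonal d * Qᴴ) = P * (Qᴴ * Q) * diagonal d * Qᴴ := by simp only [mul_assoc]
    _ = P * diagonal d * (Pᴴ * P) * Qᴴ := by rw [hQ', hP', mul_one, mul_one]
    _ = _ := by simp only [mul_assoc]

/-! ### Dimension counts on a hyperplane and rank one determinants -/

theorem quadratic_form_diagonal (P : Matrix (Fin n) (Fin n) ℂ) (d x : Fin n → ℂ) :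
    star x ⬝ᵥ ((P * diagonal d * Pᴴ) *ᵥ x) = ∑ k, d k * (‖(Pᴴ *ᵥ x) k‖ ^ 2 : ℝ) := by
  have h : star x ᵥ* P = star (Pᴴ *ᵥ x) := by
    rw [star_mulVec, conjTranspose_conjTranspose]
  rw [← mulVec_mulVec, ← mulVec_mulVec, dotProduct_mulVec, h, dotProduct]
  refine Finset.sum_congr rfl fun k _ => ?_
  rw [mulVec_diagonal, Pi.star_apply, Complex.star_def, mul_left_comm, Complex.conj_mul']
  push_cast
  rfl

/-- Two unitary matrices that agree on a hyperplane: the spectral subspaces of the first for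
a closed half plane and of the second for the complementary open half plane cannot be too large. -/
theorem card_add_card_le_of_eq_on_hyperplane {P Q : Matrix (Fin n) (Fin n) ℂ}
    (hP : P * Pᴴ = 1) (hQ : Q * Qᴴ = 1) {u v w : Fin n → ℂ}
    (hUV : ∀ x, w ⬝ᵥ x = 0 → (P * diagonal u * Pᴴ) *ᵥ x = (Q * diagonal v * Qᴴ) *ᵥ x)
    {S T : Finset (Fin n)} {c : ℂ} {a : ℝ} (hS : ∀ k ∈ S, a ≤ (c * u k).re)
    (hT : ∀ k ∈ T, (c * v k).re < a) : S.card + T.card ≤ n + 1 := by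
  by_contra! hcard
  -- A kernel vector of f lies in the spectral subspace of S, in that of T, and in the hyperplane of
  -- w. There are (n - |S|) + (n - |T|) + 1 < n conditions, so a nonzero one exists; its quadratic
  -- form, computed in the two eigenbases, is both ≥ a‖x‖² and < a‖x‖².
  let f : (Fin n → ℂ) →ₗ[ℂ] ({k // k ∈ Sᶜ} → ℂ) × ({k // k ∈ Tᶜ} → ℂ) × ℂ :=
    (LinearMap.pi fun k => (LinearMap.proj k.1).comp Pᴴ.mulVecLin).prod
      ((LinearMap.pi fun k => (LinearMap.proj k.1).comp Qᴴ.mulVecLin).prod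
        (dotProductBilin ℂ ℂ w))
  have hker : LinearMap.ker f ≠ ⊥ := by
    apply LinearMap.ker_ne_bot_of_finrank_lt
    simp only [Module.finrank_prod, Module.finrank_fintype_fun_eq_card, Fintype.card_coe,
      Finset.card_compl, Fintype.card_fin, Module.finrank_self]
    have h1 := S.card_le_univ
    have h2 := T.card_le_univ
    simp only [Fintype.card_fin] at h1 h2
    omega
  obtain ⟨x, hx, hx0⟩ := (Submodule.ne_bot_iff _).1 hker
  rw [LinearMap.mem_ker] at hx
  have hxS : ∀ k ∉ S, (Pᴴ *ᵥ x) k = 0 := fun k hk =>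
    congrFun (congrArg Prod.fst hx) ⟨k, Finset.mem_compl.2 hk⟩
  have hxT : ∀ k ∉ T, (Qᴴ *ᵥ x) k = 0 := fun k hk =>
    congrFun (congrArg (fun p => p.2.1) hx) ⟨k, Finset.mem_compl.2 hk⟩
  have hxw : w ⬝ᵥ x = 0 := congrArg (fun p => p.2.2) hx
  have hform := congrArg (fun z => (c * (star x ⬝ᵥ z)).re) (hUV x hxw)
  simp only [quadratic_form_diagonal, Finset.mul_sum, Complex.re_sum] at hform
  have hnorm : ∀ R : Matrix (Fin n) (Fin n) ℂ, R * Rᴴ = 1 →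
      (∑ k, ‖(Rᴴ *ᵥ x) k‖ ^ 2 : ℝ) = (star x ⬝ᵥ x).re := by
    intro R hR
    have := quadratic_form_diagonal R (fun _ => 1) x
    rw [diagonal_one, mul_one, hR, one_mulVec] at this
    rw [this]
    simp only [one_mul, Complex.re_sum, Complex.ofReal_re]
  have e1 : ∀ (z : ℂ) (r : ℝ), (c * (z * (r : ℂ))).re = (c * z).re * r := by
    intro z r
    rw [← mul_assoc, Complex.re_mul_ofReal]
  simp only [e1] at hform
  have h1 : a * (star x ⬝ᵥ x).re ≤ ∑ k, (c * u k).re * ‖(Pᴴ *ᵥ x) k‖ ^ 2 := by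
    rw [← hnorm P hP, Finset.mul_sum]
    refine Finset.sum_le_sum fun k _ => ?_
    by_cases hk : k ∈ S
    · exact mul_le_mul_of_nonneg_right (hS k hk) (by positivity)
    · simp [hxS k hk]
  have h2 : ∑ k, (c * v k).re * ‖(Qᴴ *ᵥ x) k‖ ^ 2 < a * (star x ⬝ᵥ x).re := by
    rw [← hnorm Q hQ, Finset.mul_sum]
    have hle : ∀ k, (c * v k).re * ‖(Qᴴ *ᵥ x) k‖ ^ 2 ≤ a * ‖(Qᴴ *ᵥ x) k‖ ^ 2 := by
      intro k
      by_cases hk : k ∈ T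
      · exact mul_le_mul_of_nonneg_right (hT k hk).le (by positivity)
      · simp [hxT k hk]
    obtain ⟨k, hk⟩ : ∃ k, (Qᴴ *ᵥ x) k ≠ 0 := by
      by_contra! h
      apply hx0
      have : Q *ᵥ (Qᴴ *ᵥ x) = 0 := by
        rw [show Qᴴ *ᵥ x = 0 from funext h, mulVec_zero]
      rwa [mulVec_mulVec, hQ, one_mulVec] at this
    refine Finset.sum_lt_sum (fun k _ => hle k) ⟨k, Finset.mem_univ _, ?_⟩
    have hkT : k ∈ T := by
      by_contra h
      exact hk (hxT k h)
    exact mul_lt_mul_of_pos_right (hT k hkT) (by positivity)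
  linarith

/-- The determinant of a rank one perturbation of an invertible diagonal matrix. -/
theorem det_diagonal_sub_vecMulVec {a u w : Fin n → ℂ} (ha : ∀ i, a i ≠ 0) :
    (diagonal a - vecMulVec u w).det = (∏ i, a i) * (1 - ∑ i, w i * u i / a i) := by
  have h : diagonal a - vecMulVec u w = diagonal a *
      (1 + replicateCol Unit (fun i => -(u i / a i)) * replicateRow Unit w) := by
    ext i j
    rw [mul_add, mul_one, Matrix.add_apply, Matrix.sub_apply, diagonal_mul, mul_apply, vecMulVec_apply]
    simp only [replicateCol_apply, replicateRow_apply, Finset.univ_unique, Finset.sum_const,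
      Finset.card_singleton, one_smul]
    field_simp [ha i]
    ring
  rw [h, det_mul, det_diagonal, det_one_add_replicateCol_mul_replicateRow, dotProduct]
  simp only [mul_neg, Finset.sum_neg_distrib, mul_div_assoc, sub_eq_add_neg]

/-! ### Half-angles, the unit circle and the alcove -/

/-- The half-angles of the diagonal entries of `δ(ξ)`. -/
def halfAngle (n : ℕ) (ξ : Fin n → ℝ) (k : Fin n) : ℝ :=
  (∑ j : Fin n, ((j : ℝ) + 1) * ξ j) / (n : ℝ) + ∑ j ∈ Finset.Iio k, ξ j

/-- The point of the unit circle with half-angle `x`. -/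
def circ (x : ℝ) : ℂ := Complex.exp (2 * Complex.I * (x : ℂ))

theorem delta_eq (ξ : Fin n → ℝ) : delta n ξ = diagonal fun k => circ (halfAngle n ξ k) := by
  unfold delta circ halfAngle
  push_cast
  rfl

theorem circ_add (x y : ℝ) : circ (x + y) = circ x * circ y := by
  unfold circ
  rw [← Complex.exp_add]
  push_cast
  ring_nf

theorem circ_int_mul_pi (m : ℤ) : circ (m * Real.pi) = 1 := by
  unfold circ
  rw [Complex.exp_eq_one_iff]
  exact ⟨m, by push_cast; ring⟩

theorem circ_zero : circ 0 = 1 := by simp [circ]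

theorem circ_ne_zero (x : ℝ) : circ x ≠ 0 := Complex.exp_ne_zero _

theorem star_circ (x : ℝ) : star (circ x) = circ (-x) := by
  unfold circ
  rw [show ∀ z : ℂ, star (Complex.exp z) = Complex.exp (star z) from
    fun z => (Complex.exp_conj z).symm]
  simp

theorem circ_mul_star (x : ℝ) : circ x * star (circ x) = 1 := by
  rw [star_circ, ← circ_add, add_neg_cancel, circ_zero]

theorem circ_eq_circ_iff {x y : ℝ} : circ x = circ y ↔ ∃ m : ℤ, x = y + m * Real.pi := by
  unfold circ
  rw [Complex.exp_eq_exp_iff_exists_int]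
  refine exists_congr fun m => ⟨fun h => ?_, fun h => ?_⟩
  · have := congrArg Complex.im h
    simp at this
    linarith
  · rw [h]; push_cast; ring

theorem circ_eq_one_iff {x : ℝ} : circ x = 1 ↔ ∃ m : ℤ, x = m * Real.pi := by
  rw [← circ_zero, circ_eq_circ_iff]
  simp

theorem circ_nat_mul (m : ℕ) (y : ℝ) : circ (m * y) = circ y ^ m := by
  unfold circ
  rw [← Complex.exp_nat_mul]
  push_cast
  ring_nf

theorem re_circ (x : ℝ) : (circ x).re = Real.cos (2 * x) := by
  unfold circ
  rw [show 2 * Complex.I * (x : ℂ) = ((2 * x : ℝ) : ℂ) * Complex.I by push_cast; ring,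
    Complex.exp_ofReal_mul_I_re]

theorem exists_eq_circ {z : ℂ} (hz : z * star z = 1) :
    ∃ x : ℝ, 0 ≤ x ∧ x < Real.pi ∧ z = circ x := by
  have hn : ‖z‖ = 1 := by
    have := congrArg norm hz
    rw [norm_mul, norm_star, norm_one] at this
    nlinarith [norm_nonneg z]
  have hz' : z = circ (z.arg / 2) := by
    conv_lhs => rw [← Complex.norm_mul_exp_arg_mul_I z, hn]
    unfold circ
    push_cast
    rw [one_mul]
    ring_nf
  have hpi := Real.pi_pos
  have h1 := Complex.neg_pi_lt_arg z
  have h2 := Complex.arg_le_pi z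
  by_cases h : 0 ≤ z.arg
  · exact ⟨z.arg / 2, by linarith, by linarith, hz'⟩
  · refine ⟨z.arg / 2 + Real.pi, by linarith, by push Not at h; linarith, ?_⟩
    rw [circ_add, ← one_mul Real.pi]
    have := circ_int_mul_pi 1
    push_cast at this
    rw [this, mul_one]
    exact hz'

theorem prod_circ {ι : Type*} (s : Finset ι) (x : ι → ℝ) :
    ∏ k ∈ s, circ (x k) = circ (∑ k ∈ s, x k) := by
  classical
  induction s using Finset.induction_on with
  | empty => simp [circ_zero]
  | insert a s ha ih => rw [Finset.prod_insert ha, Finset.sum_insert ha, circ_add, ih]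

theorem sum_sum_Iio (ξ : Fin n → ℝ) :
    ∑ k : Fin n, ∑ j ∈ Finset.Iio k, ξ j = ∑ j : Fin n, ((n : ℝ) - 1 - j) * ξ j := by
  rw [Finset.sum_comm' (t' := Finset.univ) (s' := fun j => Finset.Ioi j) (by simp)]
  refine Finset.sum_congr rfl fun j _ => ?_
  rw [Finset.sum_const, Fin.card_Ioi, nsmul_eq_mul]
  have := j.isLt
  rw [Nat.cast_sub (by omega), Nat.cast_sub (by omega)]
  push_cast
  ring

/-- Half-angles in increasing order, spread over at most `π` and with sum `nπ`, come from a point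
of the alcove. -/
theorem exists_halfAngle_eq (hn : n ≠ 0) {x : Fin n → ℝ} (hmono : Monotone x)
    (hspread : ∀ i j, x i ≤ x j + Real.pi) (hsum : ∑ k, x k = n * Real.pi) :
    ∃ ξ ∈ alcove n, halfAngle n ξ = x := by
  obtain ⟨m, rfl⟩ := Nat.exists_eq_succ_of_ne_zero hn
  -- The gaps between successive half-angles; the last one closes the circle, whose length in
  -- half-angles is π.
  let ξ : Fin (m + 1) → ℝ := fun j =>
    if h : (j : ℕ) + 1 < m + 1 then x ⟨j + 1, h⟩ - x j else Real.pi + x 0 - x j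
  have hpart : ∀ k : ℕ, ∀ hk : k < m + 1, ∑ j ∈ Finset.Iio (⟨k, hk⟩ : Fin (m + 1)), ξ j
      = x ⟨k, hk⟩ - x 0 := by
    intro k
    induction k with
    | zero =>
      intro hk
      have : Finset.Iio (⟨0, hk⟩ : Fin (m + 1)) = ∅ := by
        ext j; simp
      rw [this]
      simp
    | succ k ih =>
      intro hk
      have : Finset.Iio (⟨k + 1, hk⟩ : Fin (m + 1))
          = insert ⟨k, by omega⟩ (Finset.Iio (⟨k, by omega⟩ : Fin (m + 1))) := by
        ext j
        simp only [Finset.mem_Iio, Finset.mem_insert, Fin.lt_def, Fin.ext_iff]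
        omega
      rw [this, Finset.sum_insert (by simp), ih]
      simp only [ξ, dif_pos hk]
      ring
  have htot : ∑ j, ξ j = Real.pi := by
    have : (Finset.univ : Finset (Fin (m + 1))) = insert ⟨m, by omega⟩
        (Finset.Iio (⟨m, by omega⟩ : Fin (m + 1))) := by
      ext j
      have := j.isLt
      simp only [Finset.mem_Iio, Finset.mem_insert, Fin.lt_def, Fin.ext_iff, Finset.mem_univ,
        true_iff]
      omega
    rw [this, Finset.sum_insert (by simp), hpart]
    simp only [ξ, lt_irrefl, dite_false]
    ring
  refine ⟨ξ, ⟨htot, fun j => ?_⟩, ?_⟩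
  · simp only [ξ]
    split_ifs with h
    · exact sub_nonneg.2 (hmono (by simp [Fin.le_def]))
    · have := hspread j 0
      linarith
  · have h1 : ∑ k : Fin (m + 1), ∑ j ∈ Finset.Iio k, ξ j
        = (m + 1 : ℕ) * Real.pi - (m + 1 : ℕ) * x 0 := by
      rw [Finset.sum_congr rfl fun (k : Fin (m + 1)) _ => hpart k k.isLt, Finset.sum_sub_distrib, hsum]
      simp
    -- The normalization of δ₁ amounts to the half-angles having sum nπ, so the prescribed sum
    -- recovers x 0.
    have h2 : ∑ j : Fin (m + 1), ((j : ℝ) + 1) * ξ j = (m + 1 : ℕ) * x 0 := by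
      rw [sum_sum_Iio] at h1
      have h3 : ∑ j : Fin (m + 1), (((m + 1 : ℕ) : ℝ) - 1 - j) * ξ j
          + ∑ j : Fin (m + 1), ((j : ℝ) + 1) * ξ j = (m + 1 : ℕ) * Real.pi := by
        rw [← Finset.sum_add_distrib, ← htot, Finset.mul_sum]
        exact Finset.sum_congr rfl fun j _ => by ring
      linarith
    funext k
    rw [halfAngle, h2, hpart k k.isLt]
    field_simp
    simp

theorem coe_mul_conjTranspose (g : SU n) :
    (g : Matrix (Fin n) (Fin n) ℂ) * (g : Matrix (Fin n) (Fin n) ℂ)ᴴ = 1 :=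
  mem_unitaryGroup_iff.1 (mem_specialUnitaryGroup_iff.1 g.2).1

theorem coe_inv_eq (g : SU n) :
    ((g⁻¹ : SU n) : Matrix (Fin n) (Fin n) ℂ) = (g : Matrix (Fin n) (Fin n) ℂ)ᴴ := rfl

theorem isConj_diagonal_comp (d : Fin n → ℂ) (σ : Equiv.Perm (Fin n)) :
    IsConj (diagonal d) (diagonal (d ∘ σ)) := by
  let R : Matrix (Fin n) (Fin n) ℂ := (1 : Matrix (Fin n) (Fin n) ℂ).submatrix σ id
  let R' : Matrix (Fin n) (Fin n) ℂ := (1 : Matrix (Fin n) (Fin n) ℂ).submatrix id σ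
  have h1 : R' * R = 1 := by simp [R, R', submatrix_mul_equiv]
  have h2 : R * R' = 1 := mul_eq_one_comm.1 h1
  refine ⟨⟨R, R', h2, h1⟩, ?_⟩
  change R * diagonal d = diagonal (d ∘ σ) * R
  rw [← submatrix_diagonal _ _ σ.injective]
  ext i j
  simp only [R, mul_diagonal, submatrix_apply]
  rw [submatrix_diagonal _ _ σ.injective, diagonal_mul, submatrix_apply, id, Function.comp,
    one_apply]
  split_ifs with h
  · subst h; simp
  · simp

/-- Every element of `SU(n)` is similar to some `δ(ξ)`. -/
theorem exists_alcove_isConj (hn : n ≠ 0) (g : SU n) :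
    ∃ ξ, ξ ∈ alcove n ∧ IsConj (g : Matrix (Fin n) (Fin n) ℂ) (delta n ξ) := by
  obtain ⟨P, d, hP, hP', hg⟩ := unitary_diagonalization (coe_mul_conjTranspose g)
  have hdiag : (g : Matrix (Fin n) (Fin n) ℂ) * P = P * diagonal d := by
    rw [hg, mul_assoc, hP', mul_one]
  have hd : diagonal d * (diagonal d)ᴴ = 1 := by
    have : diagonal d = Pᴴ * g * P := by
      rw [mul_assoc, hdiag, ← mul_assoc, hP', one_mul]
    rw [this, conjTranspose_mul, conjTranspose_mul, conjTranspose_conjTranspose]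
    calc Pᴴ * ↑g * P * (Pᴴ * ((g : Matrix (Fin n) (Fin n) ℂ)ᴴ * P))
        = Pᴴ * (g * (P * Pᴴ) * (g : Matrix (Fin n) (Fin n) ℂ)ᴴ) * P := by simp only [mul_assoc]
      _ = 1 := by rw [hP, mul_one, coe_mul_conjTranspose, mul_one, hP']
  have hd' : ∀ i, d i * star (d i) = 1 := by
    intro i
    have := congrFun (congrFun hd i) i
    simpa [diagonal_conjTranspose] using this
  choose x₀ hx0 hxpi hdx using fun i => exists_eq_circ (hd' i)
  set x : Fin n → ℝ := x₀ ∘ Tuple.sort x₀ with hx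
  have hxm : Monotone x := Tuple.monotone_sort x₀
  have hprod : ∏ i, d i = 1 := by
    have h1 := (mem_specialUnitaryGroup_iff.1 g.2).2
    rw [hg, det_mul_comm, ← mul_assoc, hP', one_mul, det_diagonal] at h1
    exact h1
  obtain ⟨m, hm⟩ : ∃ m : ℤ, ∑ k, x k = m * Real.pi := by
    rw [← circ_eq_one_iff, hx]
    have : ∑ k, (x₀ ∘ Tuple.sort x₀) k = ∑ k, x₀ k := Equiv.sum_comp (Tuple.sort x₀) x₀
    rw [this, ← prod_circ, ← hprod]
    exact Finset.prod_congr rfl fun i _ => (hdx i).symm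
  have hpi := Real.pi_pos
  have hm0 : 0 ≤ m := by
    have : 0 ≤ (m : ℝ) * Real.pi := hm ▸ Finset.sum_nonneg fun k _ => hx0 _
    have := nonneg_of_mul_nonneg_left this hpi
    exact_mod_cast this
  have hmn : m ≤ n := by
    have : (m : ℝ) * Real.pi ≤ n * Real.pi := by
      rw [← hm]
      calc ∑ k, x k ≤ ∑ _k : Fin n, Real.pi := Finset.sum_le_sum fun k _ => (hxpi _).le
        _ = _ := by simp
    have := le_of_mul_le_mul_right this hpi
    exact_mod_cast this
  -- Raising the l = n - m smallest half-angles by π changes no eigenvalue, brings the sum from mπ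
  -- to nπ and keeps the spread at most π.
  obtain ⟨l, hl⟩ : ∃ l : ℕ, (l : ℤ) = n - m := ⟨(n - m).toNat, by omega⟩
  set z₀ : Fin n → ℝ := fun k => x k + if (k : ℕ) < l then Real.pi else 0 with hz₀
  set z : Fin n → ℝ := z₀ ∘ Tuple.sort z₀ with hz
  have hzm : Monotone z := Tuple.monotone_sort z₀
  have hsum : ∑ k, z k = n * Real.pi := by
    have : ∑ k, z k = ∑ k, z₀ k := Equiv.sum_comp (Tuple.sort z₀) z₀
    rw [this, hz₀, Finset.sum_add_distrib, hm, Finset.sum_ite, Finset.sum_const, Finset.sum_const_zero,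
      add_zero, nsmul_eq_mul]
    have hc : (Finset.univ.filter fun k : Fin n => (k : ℕ) < l).card = l := by
      rw [Fin.card_filter_val_lt]
      omega
    rw [hc]
    have : (l : ℝ) = n - m := by exact_mod_cast hl
    rw [this]
    ring
  have hspread₀ : ∀ i j, z₀ i ≤ z₀ j + Real.pi := by
    intro i j
    have h1 : x i < Real.pi := hxpi _
    have h2 : 0 ≤ x j := hx0 _
    simp only [hz₀]
    split_ifs with hi hj
    · linarith
    · have : x i ≤ x j := hxm (by rw [Fin.le_def]; omega)
      linarith
    · linarith
    · linarith
  obtain ⟨ξ, hξ, hang⟩ := exists_halfAngle_eq hn hzm (fun i j => hspread₀ _ _) hsum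
  refine ⟨ξ, hξ, ?_⟩
  have hgd : IsConj (g : Matrix (Fin n) (Fin n) ℂ) (diagonal d) := by
    refine ⟨⟨Pᴴ, P, hP', hP⟩, ?_⟩
    change Pᴴ * g = diagonal d * Pᴴ
    rw [hg, ← mul_assoc, ← mul_assoc, hP', one_mul]
  have hdz : (fun k => circ (z k)) = d ∘ ((Tuple.sort z₀).trans (Tuple.sort x₀)) := by
    funext k
    have hcz : ∀ i, circ (z₀ i) = circ (x i) := by
      intro i
      simp only [hz₀]
      split_ifs
      · rw [circ_add]
        have := circ_int_mul_pi 1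
        rw [Int.cast_one, one_mul] at this
        rw [this, mul_one]
      · rw [add_zero]
    simp only [hz, Function.comp, hcz, hx, Equiv.trans_apply, hdx]
  rw [delta_eq, hang, hdz]
  exact hgd.trans (isConj_diagonal_comp d _)

/-- Existence alone determines these two properties of the chosen point; uniqueness of ξ is never
needed. -/
theorem Xi_spec (hn : n ≠ 0) (g : SU n) :
    Xi g ∈ alcove n ∧ IsConj (g : Matrix (Fin n) (Fin n) ℂ) (delta n (Xi g)) :=
  Classical.epsilon_spec (exists_alcove_isConj hn g)

theorem halfAngle_lt {ξ : Fin n → ℝ} (h : ∀ i, 0 < ξ i) {i j : Fin n} (hij : i < j) :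
    halfAngle n ξ i < halfAngle n ξ j := by
  unfold halfAngle
  have : ∑ k ∈ Finset.Iio i, ξ k < ∑ k ∈ Finset.Iio j, ξ k :=
    Finset.sum_lt_sum_of_subset (i := i) (Finset.Iio_subset_Iio hij.le) (by simpa) (by simp)
      (h i) (fun k _ _ => (h k).le)
  linarith

/-- For a regular `ξ` the diagonal entries of `δ(ξ)` are pairwise distinct. -/
theorem circ_halfAngle_injective {ξ : Fin n → ℝ} (hξ : ξ ∈ alcoveReg n) :
    Function.Injective fun k => circ (halfAngle n ξ k) := by
  refine Function.Injective.of_lt_imp_ne ?_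
  intro i j hij h
  obtain ⟨m, hm⟩ := circ_eq_circ_iff.1 h.symm
  have h1 := halfAngle_lt hξ.2 hij
  have h2 : halfAngle n ξ j - halfAngle n ξ i < Real.pi := by
    unfold halfAngle
    have h3 : ∑ k ∈ Finset.Iio j, ξ k < ∑ k, ξ k :=
      Finset.sum_lt_sum_of_subset (i := j) (Finset.subset_univ _) (by simp) (by simp)
        (hξ.2 j) (fun k _ _ => (hξ.2 k).le)
    have h4 : 0 ≤ ∑ k ∈ Finset.Iio i, ξ k := Finset.sum_nonneg fun k _ => (hξ.2 k).le
    have h5 := hξ.1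
    linarith
  have hpi := Real.pi_pos
  have h6 : (0 : ℝ) < m := by nlinarith
  have h7 : (m : ℝ) < 1 := by nlinarith
  have h6' : 0 < m := by exact_mod_cast h6
  have h7' : m < 1 := by exact_mod_cast h7
  omega

/-! ### The commutator equation and the excluded values of y -/

theorem muZeroEntry_eq (y : ℝ) (k : Fin n) :
    muZeroEntry n y k = circ y * if (k : ℕ) + 1 = n then (circ y ^ n)⁻¹ else 1 := by
  unfold muZeroEntry
  split_ifs with h
  · rw [← circ_nat_mul]
    unfold circ
    rw [← Complex.exp_neg, ← Complex.exp_add]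
    push_cast
    ring_nf
  · rw [mul_one, circ]

theorem coe_muZero (n : ℕ) (y : ℝ) :
    (muZero n y : Matrix (Fin n) (Fin n) ℂ) = diagonal (muZeroEntry n y) := rfl

theorem commMap_eq_iff (A B g : SU n) : commMap n (A, B) = g ↔
    (A : Matrix (Fin n) (Fin n) ℂ) * B = (g : Matrix (Fin n) (Fin n) ℂ) * B * A := by
  have h1 : commMap n (A, B) = g ↔ A * B = g * B * A := by
    unfold commMap
    constructor
    · intro h
      rw [← h]
      group
    · intro h
      simp only
      rw [h]
      group
  rw [h1, Subtype.ext_iff]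
  rfl

theorem div_mem_farey {i j : ℕ} (hj : 1 ≤ j) (hjn : j ≤ n) (hij : i ≤ j) :
    (i : ℝ) / j ∈ farey n := by
  have hg : 0 < Nat.gcd i j := Nat.gcd_pos_of_pos_right _ hj
  refine ⟨i / Nat.gcd i j, j / Nat.gcd i j, ?_, ?_, Nat.div_le_div_right hij,
    Nat.coprime_div_gcd_div_gcd hg, ?_⟩
  · exact Nat.div_pos (Nat.le_of_dvd hj (Nat.gcd_dvd_right i j)) hg
  · exact (Nat.div_le_self _ _).trans hjn
  · rw [Nat.cast_div (Nat.gcd_dvd_left i j) (by positivity),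
      Nat.cast_div (Nat.gcd_dvd_right i j) (by positivity)]
    field_simp

theorem exists_pow_eq_one_iff {y : ℝ} (h0 : 0 ≤ y) (h1 : y ≤ Real.pi) :
    (∃ m : ℕ, 1 ≤ m ∧ m ≤ n ∧ circ y ^ m = 1) ↔ y / Real.pi ∈ farey n := by
  have hpi := Real.pi_pos
  constructor
  · rintro ⟨m, hm, hmn, h⟩
    rw [← circ_nat_mul, circ_eq_one_iff] at h
    obtain ⟨k, hk⟩ := h
    have hm' : (0 : ℝ) < m := by exact_mod_cast hm
    have hk0 : (0 : ℝ) ≤ k := by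
      have : 0 ≤ (k : ℝ) * Real.pi := hk ▸ by positivity
      exact nonneg_of_mul_nonneg_left this hpi
    have hkm : (k : ℝ) ≤ m := by
      have : (k : ℝ) * Real.pi ≤ m * Real.pi := by
        rw [← hk]; exact mul_le_mul_of_nonneg_left h1 hm'.le
      exact le_of_mul_le_mul_right this hpi
    lift k to ℕ using by exact_mod_cast hk0
    have : y / Real.pi = (k : ℝ) / m := by
      rw [div_eq_div_iff hpi.ne' hm'.ne', mul_comm]
      exact_mod_cast hk
    rw [this]
    exact div_mem_farey hm hmn (by exact_mod_cast hkm)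
  · rintro ⟨a, b, hb, hbn, -, -, h⟩
    refine ⟨b, hb, hbn, ?_⟩
    rw [← circ_nat_mul, circ_eq_one_iff]
    refine ⟨a, ?_⟩
    have hb' : (b : ℝ) ≠ 0 := by positivity
    rw [div_eq_div_iff hpi.ne' hb'] at h
    rw [mul_comm, h]
    simp

/-- A permutation as a matrix. -/
def permMat (σ : Equiv.Perm (Fin n)) : Matrix (Fin n) (Fin n) ℂ :=
  (1 : Matrix (Fin n) (Fin n) ℂ).submatrix σ id

theorem permMat_mul_conjTranspose (σ : Equiv.Perm (Fin n)) : permMat σ * (permMat σ)ᴴ = 1 := by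
  rw [mul_eq_one_comm, permMat, conjTranspose_submatrix, submatrix_mul_equiv]
  simp

theorem permMat_mul_diagonal (σ : Equiv.Perm (Fin n)) (d : Fin n → ℂ) :
    permMat σ * diagonal d = diagonal (d ∘ σ) * permMat σ := by
  ext i j
  rw [permMat, mul_diagonal, diagonal_mul, submatrix_apply, id, Function.comp, one_apply]
  split_ifs with h
  · subst h; simp
  · simp

theorem diagonal_mul_conjTranspose {d : Fin n → ℂ} (hd : ∀ i, d i * star (d i) = 1) :
    diagonal d * (diagonal d)ᴴ = 1 := by
  rw [diagonal_conjTranspose, diagonal_mul_diagonal, ← diagonal_one]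
  congr 1
  funext i
  exact hd i

/-- A transposition matrix, rescaled into SU(n), must commute with η but swaps two of its entries.
-/
theorem apply_eq_of_mem_center (hn : n ≠ 0) {η : SU n} {h : Fin n → ℂ}
    (hη : (η : Matrix (Fin n) (Fin n) ℂ) = diagonal h) (hc : η ∈ Subgroup.center (SU n))
    (i j : Fin n) : h i = h j := by
  obtain ⟨c, hc1, hcA⟩ := exists_smul_mem_SU hn (permMat_mul_conjTranspose (Equiv.swap i j))
  have h1 := congrArg (fun g : SU n => (g : Matrix (Fin n) (Fin n) ℂ))
    (Subgroup.mem_center_iff.1 hc ⟨_, hcA⟩)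
  change (c • permMat (Equiv.swap i j)) * (η : Matrix (Fin n) (Fin n) ℂ)
    = (η : Matrix (Fin n) (Fin n) ℂ) * (c • permMat (Equiv.swap i j)) at h1
  rw [hη, smul_mul_assoc, mul_smul_comm, permMat_mul_diagonal] at h1
  have hc0 : c ≠ 0 := by rintro rfl; simp at hc1
  have h2 := congrFun (congrFun (smul_right_injective _ hc0 h1) i) j
  rw [diagonal_mul, diagonal_mul, permMat, submatrix_apply, Equiv.swap_apply_left, id, one_apply_eq,
    mul_one, mul_one] at h2
  rw [Function.comp, Equiv.swap_apply_left] at h2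
  exact h2.symm

/-- If `e^{2miy} = 1` with `1 ≤ m < n`, then the fibre contains a reducible pair. -/
theorem not_stronglyRegular {y : ℝ} {m : ℕ} (hm : 1 ≤ m) (hmn : m < n) (hq : circ y ^ m = 1) :
    ¬ StronglyRegular (muZero n y) := by
  intro hreg
  have hn : n ≠ 0 := by omega
  -- Two cycles, on {0, ..., m - 1} and {m, ..., n - 1}. With B proportional to diag(q^k), the
  -- relation q^m = 1 makes both wrap-around steps consistent with the entries of μ₀(y).
  let f : Fin n → Fin n := fun k =>
    if k.1 + 1 = m then ⟨0, by omega⟩ else if h : k.1 + 1 = n then ⟨m, hmn⟩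
      else ⟨k.1 + 1, by omega⟩
  have hf : Function.Injective f := by
    intro j k hjk
    simp only [f, Fin.ext_iff] at hjk ⊢
    split_ifs at hjk <;> simp only at hjk <;> omega
  let σ : Equiv.Perm (Fin n) := Equiv.ofBijective f (Finite.injective_iff_bijective.1 hf)
  have hσ : ∀ k, σ k = f k := fun k => rfl
  let d : Fin n → ℂ := fun k => circ y ^ (k : ℕ)
  -- Constant on each cycle, hence commuting with A and B. The half-angles are balanced so that the
  -- determinant is 1, and they differ by π/2, so the two entries are opposite and η is not central.
  let h : Fin n → ℂ := fun k =>
    circ (if (k : ℕ) < m then (n - m) * Real.pi / (2 * n) else -(m * Real.pi / (2 * n)))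
  have hq0 := circ_ne_zero y
  have hdσ : ∀ k, (d ∘ σ) k = muZeroEntry n y k * d k := by
    intro k
    have hk := k.isLt
    rw [muZeroEntry_eq, Function.comp, hσ]
    simp only [f, d]
    split_ifs with h1 h2 h2
    · omega
    · simp only [pow_zero, mul_one]
      rw [← pow_succ', h1, hq]
    · have : circ y ^ n = circ y * circ y ^ (k : ℕ) := by rw [← pow_succ', h2]
      rw [this, hq]
      field_simp
    · simp only [mul_one, pow_succ']
  have hhσ : h ∘ σ = h := by
    funext k
    have hk := k.isLt
    simp only [Function.comp, hσ, h, f]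
    congr 1
    split_ifs <;> first | rfl | (simp only at *; omega)
  have hdu : ∀ k, d k * star (d k) = 1 := by
    intro k
    simp only [d, ← circ_nat_mul, circ_mul_star]
  obtain ⟨c, hc, hA⟩ := exists_smul_mem_SU hn (permMat_mul_conjTranspose σ)
  obtain ⟨c', hc', hB⟩ := exists_smul_mem_SU hn (diagonal_mul_conjTranspose hdu)
  have hηmem : diagonal h ∈ specialUnitaryGroup (Fin n) ℂ := by
    rw [mem_specialUnitaryGroup_iff, mem_unitaryGroup_iff, star_eq_conjTranspose]
    refine ⟨diagonal_mul_conjTranspose fun k => circ_mul_star _, ?_⟩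
    rw [det_diagonal, prod_circ, ← circ_zero]
    congr 1
    rw [Finset.sum_ite, Finset.sum_const, Finset.sum_const, Finset.filter_not,
      Finset.card_sdiff_of_subset (Finset.filter_subset _ _), Fin.card_filter_val_lt,
      Finset.card_univ, Fintype.card_fin, min_eq_right hmn.le, nsmul_eq_mul, nsmul_eq_mul,
      Nat.cast_sub hmn.le]
    ring
  let A : SU n := ⟨_, hA⟩
  let B : SU n := ⟨_, hB⟩
  let η : SU n := ⟨_, hηmem⟩
  have hcomm : commMap n (A, B) = muZero n y := by
    rw [commMap_eq_iff]
    change c • permMat σ * (c' • diagonal d) = diagonal (muZeroEntry n y) * (c' • diagonal d)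
      * (c • permMat σ)
    simp only [smul_mul_assoc, mul_smul_comm]
    rw [smul_comm, permMat_mul_diagonal, diagonal_mul_diagonal,
      show d ∘ σ = fun k => muZeroEntry n y k * d k from funext hdσ]
  have hηA : η * A = A * η := by
    apply Subtype.ext
    change diagonal h * (c • permMat σ) = c • permMat σ * diagonal h
    rw [mul_smul_comm, smul_mul_assoc, permMat_mul_diagonal, hhσ]
  have hηB : η * B = B * η := by
    apply Subtype.ext
    change diagonal h * (c' • diagonal d) = c' • diagonal d * diagonal h
    rw [mul_smul_comm, smul_mul_assoc, diagonal_mul_diagonal, diagonal_mul_diagonal]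
    simp only [mul_comm]
  have hiso : η ∈ isotropy (muZero n y) := by
    rw [isotropy, Subgroup.mem_centralizer_singleton_iff]
    apply Subtype.ext
    change diagonal h * diagonal (muZeroEntry n y) = diagonal (muZeroEntry n y) * diagonal h
    rw [diagonal_mul_diagonal, diagonal_mul_diagonal]
    simp only [mul_comm]
  have hfix : conjPair η (A, B) = (A, B) := by
    unfold conjPair
    simp only
    rw [hηA, hηB, mul_inv_cancel_right, mul_inv_cancel_right]
  have := apply_eq_of_mem_center hn (h := h) rfl (hreg _ hcomm η hiso hfix) ⟨0, by omega⟩ ⟨m, hmn⟩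
  simp only [h, lt_irrefl, if_false, show (0 : ℕ) < m from hm, if_true] at this
  rw [circ_eq_circ_iff] at this
  obtain ⟨k, hk⟩ := this
  have hn' : (n : ℝ) ≠ 0 := by exact_mod_cast hn
  have hpi := Real.pi_pos.ne'
  field_simp at hk
  have h2 : (n : ℝ) * (1 - 2 * k) = 0 := by linarith
  have h3 : (1 : ℝ) - 2 * k = 0 := (mul_eq_zero.1 h2).resolve_left hn'
  have h4 : (1 : ℤ) - 2 * k = 0 := by exact_mod_cast h3
  omega

/-- If no `e^{2miy}`, `1 ≤ m ≤ n`, equals one, then `μ₀(y)` is strongly regular. -/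
theorem stronglyRegular_of_pow_ne_one (hn : 2 ≤ n) {y : ℝ}
    (hq : ∀ m : ℕ, 1 ≤ m → m ≤ n → circ y ^ m ≠ 1) : StronglyRegular (muZero n y) := by
  rintro ⟨A, B⟩ hcomm η hη hfix
  rw [commMap_eq_iff, coe_muZero] at hcomm
  have hcA : (η : Matrix (Fin n) (Fin n) ℂ) * A = A * η := by
    have h1 : η * A * η⁻¹ = A := congrArg Prod.fst hfix
    exact congrArg Subtype.val (mul_inv_eq_iff_eq_mul.1 h1)
  have hcB : (η : Matrix (Fin n) (Fin n) ℂ) * B = B * η := by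
    have h1 : η * B * η⁻¹ = B := congrArg Prod.snd hfix
    exact congrArg Subtype.val (mul_inv_eq_iff_eq_mul.1 h1)
  have hcM : (η : Matrix (Fin n) (Fin n) ℂ) * diagonal (muZeroEntry n y)
      = diagonal (muZeroEntry n y) * η := by
    rw [isotropy, Subgroup.mem_centralizer_singleton_iff] at hη
    exact congrArg Subtype.val hη
  set E := (η : Matrix (Fin n) (Fin n) ℂ) with hE
  set MA := (A : Matrix (Fin n) (Fin n) ℂ) with hMA
  set MB := (B : Matrix (Fin n) (Fin n) ℂ) with hMB
  let last : Fin n := ⟨n - 1, by omega⟩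
  have hlast : ∀ k : Fin n, k ≠ last → ¬ ((k : ℕ) + 1 = n) := by
    intro k hk h
    apply hk
    simp only [last, Fin.ext_iff]
    omega
  -- Since q^n ≠ 1, the last entry of μ₀(y) differs from all others, so a matrix commuting with it
  -- has no off-diagonal entries in its last row.
  have hrow : ∀ j, j ≠ last → E last j = 0 := by
    intro j hj
    have h1 := congrFun (congrFun hcM last) j
    rw [mul_diagonal, diagonal_mul, muZeroEntry_eq, muZeroEntry_eq,
      if_neg (hlast j hj), if_pos (by simp only [last]; omega)] at h1
    by_contra h0
    have h2 : (1 : ℂ) = (circ y ^ n)⁻¹ := by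
      have := circ_ne_zero y
      have h3 : E last j * circ y * 1 = E last j * circ y * (circ y ^ n)⁻¹ := by
        rw [mul_assoc, h1]; ring
      exact mul_left_cancel₀ (mul_ne_zero h0 this) h3
    exact hq n (by omega) le_rfl (inv_eq_one.1 h2.symm)
  set lam := E last last with hlam
  set N := E - lam • (1 : Matrix (Fin n) (Fin n) ℂ) with hN
  by_cases hN0 : N = 0
  · have hEs : E = lam • (1 : Matrix (Fin n) (Fin n) ℂ) := sub_eq_zero.1 hN0
    rw [Subgroup.mem_center_iff]
    intro g
    apply Subtype.ext
    change (g : Matrix (Fin n) (Fin n) ℂ) * E = E * g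
    rw [hEs]
    simp
  exfalso
  have hNA : N * MA = MA * N := by
    rw [hN, sub_mul, mul_sub, hcA]; simp
  have hNB : N * MB = MB * N := by
    rw [hN, sub_mul, mul_sub, hcB]; simp
  have hNlast : ∀ x, (N *ᵥ x) last = 0 := by
    intro x
    have : ∀ j, N last j = 0 := by
      intro j
      by_cases hj : j = last
      · subst hj; simp [hN, hlam]
      · simp [hN, hrow j hj, Ne.symm hj]
    simp [mulVec, dotProduct, this]
  -- W is stable under A and B and lies in the hyperplane where the last coordinate vanishes, on
  -- which μ₀(y) is multiplication by q.
  let W := LinearMap.range N.mulVecLin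
  have hWlast : ∀ x ∈ W, x last = 0 := by
    rintro _ ⟨x, rfl⟩
    exact hNlast x
  have hWmap : ∀ Z : Matrix (Fin n) (Fin n) ℂ, N * Z = Z * N → ∀ x ∈ W, Z.mulVecLin x ∈ W := by
    rintro Z hZ _ ⟨x, rfl⟩
    refine ⟨Z *ᵥ x, ?_⟩
    simp only [mulVecLin_apply, mulVec_mulVec, hZ]
  let a := MA.mulVecLin.restrict (hWmap MA hNA)
  let b := MB.mulVecLin.restrict (hWmap MB hNB)
  have hdet : ∀ (g : SU n) (hg : N * (g : Matrix (Fin n) (Fin n) ℂ) = g * N),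
      LinearMap.det ((g : Matrix (Fin n) (Fin n) ℂ).mulVecLin.restrict (hWmap _ hg)) ≠ 0 := by
    intro g hg
    rw [← isUnit_iff_ne_zero, ← LinearMap.isUnit_iff_isUnit_det, LinearMap.isUnit_iff_ker_eq_bot,
      LinearMap.ker_eq_bot']
    intro x hx
    have h1 : (g : Matrix (Fin n) (Fin n) ℂ) *ᵥ x.1 = 0 := congrArg Subtype.val hx
    have h2 : (g : Matrix (Fin n) (Fin n) ℂ)ᴴ *ᵥ ((g : Matrix (Fin n) (Fin n) ℂ) *ᵥ x.1) = 0 := by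
      rw [h1, mulVec_zero]
    rw [mulVec_mulVec, mul_eq_one_comm.1 (coe_mul_conjTranspose g), one_mulVec] at h2
    exact Subtype.ext h2
  have hab : a ∘ₗ b = circ y • (b ∘ₗ a) := by
    ext1 x
    apply Subtype.ext
    change MA *ᵥ (MB *ᵥ x.1) = circ y • (MB *ᵥ (MA *ᵥ x.1))
    rw [mulVec_mulVec, hcomm, mul_assoc, ← mulVec_mulVec, mulVec_mulVec x.1 MB MA]
    funext k
    rw [mulVec_diagonal, Pi.smul_apply, smul_eq_mul]
    by_cases hk : k = last
    · have : ((MB * MA) *ᵥ x.1) last = 0 := by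
        rw [← mulVec_mulVec]
        exact hWlast _ (hWmap MB hNB _ (hWmap MA hNA _ x.2))
      rw [hk, this]; simp
    · rw [muZeroEntry_eq, if_neg (hlast k hk), mul_one]
  -- From AB = qBA on W, determinants yield q^{dim W} = 1, and 1 ≤ dim W ≤ n.
  have hdets := congrArg LinearMap.det hab
  rw [LinearMap.det_smul, LinearMap.det_comp, LinearMap.det_comp, mul_comm (LinearMap.det b)] at hdets
  have hpow : circ y ^ Module.finrank ℂ W = 1 := by
    have := mul_ne_zero (hdet A hNA) (hdet B hNB)
    exact (mul_right_cancel₀ this ((one_mul _).trans hdets)).symm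
  refine hq _ ?_ ?_ hpow
  · rw [Nat.one_le_iff_ne_zero, Ne, Submodule.finrank_eq_zero]
    intro h
    apply hN0
    have h1 : N.mulVecLin = 0 := LinearMap.range_eq_bot.1 h
    ext i j
    have := congrFun (LinearMap.congr_fun h1 (Pi.single j 1)) i
    simpa using this
  · calc Module.finrank ℂ W ≤ Module.finrank ℂ (Fin n → ℂ) := Submodule.finrank_le _
      _ = n := by simp

/-- The parameter `y` is excluded exactly if `e^{2miy} = 1` for some `m ≤ n`. -/
theorem not_isAdmissible_iff (hn : 2 ≤ n) (y : ℝ) :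
    ¬ IsAdmissible n y ↔ ∃ m : ℕ, 1 ≤ m ∧ m ≤ n ∧ circ y ^ m = 1 := by
  constructor
  · intro h
    by_contra! hq
    refine h ⟨stronglyRegular_of_pow_ne_one hn hq, ?_⟩
    rintro ⟨c, hc⟩
    rw [coe_muZero, smul_one_eq_diagonal] at hc
    have hc' := diagonal_injective hc
    have h0 := congrFun hc' ⟨0, by omega⟩
    have h1 := congrFun hc' ⟨n - 1, by omega⟩
    rw [muZeroEntry_eq, if_neg (by simp only; omega), mul_one] at h0
    rw [muZeroEntry_eq, if_pos (by simp only; omega), ← h0] at h1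
    exact hq n (by omega) le_rfl (inv_eq_one.1 (mul_eq_left₀ (circ_ne_zero y) |>.1 h1))
  · rintro ⟨m, hm, hmn, hq⟩ ⟨hreg, hsc⟩
    rcases hmn.lt_or_eq with h | rfl
    · exact not_stronglyRegular hm h hq hreg
    · refine hsc ⟨circ y, ?_⟩
      rw [coe_muZero, smul_one_eq_diagonal]
      congr 1
      funext k
      rw [muZeroEntry_eq, hq]
      simp

theorem isAdmissible_of_neighbours (hn : 2 ≤ n) {p q y : ℝ} (h : FareyNeighbours n p q)
    (hy : y / Real.pi ∈ Set.Ioo p q) : IsAdmissible n y := by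
  obtain ⟨⟨a, b, hb, -, hab, -, rfl⟩, ⟨c, d, hd, -, hcd, -, rfl⟩, -, hno⟩ := h
  by_contra hadm
  rw [not_isAdmissible_iff hn] at hadm
  have hpi := Real.pi_pos
  have h0 : 0 ≤ y := by
    have : 0 ≤ y / Real.pi := le_trans (by positivity) hy.1.le
    rw [le_div_iff₀ hpi] at this; linarith
  have h1 : y ≤ Real.pi := by
    have : (c : ℝ) / d ≤ 1 := by
      rw [div_le_one (by positivity)]; exact_mod_cast hcd
    have := hy.2.le.trans this
    rwa [div_le_one hpi] at this
  exact hno _ ((exists_pow_eq_one_iff h0 h1).1 hadm) hy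

/-! ### Quasi-periodic half-angles and interlacing -/

/-- The residue of an integer modulo `n`, as an index. -/
def resIdx (hn : n ≠ 0) (j : ℤ) : Fin n :=
  ⟨(j % n).toNat, by
    have h1 := Int.emod_nonneg j (b := n) (by exact_mod_cast hn)
    have h2 := Int.emod_lt_of_pos j (b := n) (by omega)
    omega⟩

theorem resIdx_val (hn : n ≠ 0) (j : ℤ) : ((resIdx hn j : ℕ) : ℤ) = j % n := by
  rw [resIdx]
  exact Int.toNat_of_nonneg (Int.emod_nonneg j (by exact_mod_cast hn))

theorem resIdx_natCast (hn : n ≠ 0) (k : Fin n) : resIdx hn (k : ℕ) = k := by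
  apply Fin.ext
  have := resIdx_val hn (k : ℕ)
  rw [Int.emod_eq_of_lt (by omega) (by exact_mod_cast k.isLt)] at this
  exact_mod_cast this

theorem resIdx_injOn (hn : n ≠ 0) {a b : ℤ} (h : b - a < n) :
    Set.InjOn (resIdx hn) (Finset.Icc a b : Set ℤ) := by
  intro x hx z hz hxz
  rw [Finset.coe_Icc, Set.mem_Icc] at hx hz
  have h1 : x % n = z % n := by rw [← resIdx_val hn, ← resIdx_val hn, hxz]
  have h3 : (n : ℤ) ∣ x - z := Int.ModEq.dvd (Int.ModEq.symm h1)
  have h4 : x - z = 0 := Int.eq_zero_of_abs_lt_dvd h3 (by rw [abs_lt]; constructor <;> omega)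
  omega

/-- The half-angles of `δ(ξ)`, extended quasi-periodically to all integers. -/
def liftAngle (hn : n ≠ 0) (ξ : Fin n → ℝ) (j : ℤ) : ℝ :=
  halfAngle n ξ (resIdx hn j) + ((j / n : ℤ) : ℝ) * Real.pi

theorem circ_liftAngle (hn : n ≠ 0) (ξ : Fin n → ℝ) (j : ℤ) :
    circ (liftAngle hn ξ j) = circ (halfAngle n ξ (resIdx hn j)) := by
  rw [liftAngle, circ_add, circ_int_mul_pi, mul_one]

theorem liftAngle_add_mul (hn : n ≠ 0) (ξ : Fin n → ℝ) (j m : ℤ) :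
    liftAngle hn ξ (j + m * n) = liftAngle hn ξ j + m * Real.pi := by
  have h1 : resIdx hn (j + m * n) = resIdx hn j := by
    apply Fin.ext
    have := (resIdx_val hn (j + m * n)).trans (Int.add_mul_emod_self_right j m n)
    rw [← resIdx_val hn] at this
    exact_mod_cast this
  rw [liftAngle, liftAngle, h1, Int.add_mul_ediv_right _ _ (by exact_mod_cast hn)]
  push_cast
  ring

theorem liftAngle_add_one (hn : n ≠ 0) {ξ : Fin n → ℝ} (hξ : ∑ i, ξ i = Real.pi) (j : ℤ) :
    liftAngle hn ξ (j + 1) = liftAngle hn ξ j + ξ (resIdx hn j) := by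
  have hr0 := Int.emod_nonneg j (b := n) (by exact_mod_cast hn)
  have hr1 := Int.emod_lt_of_pos j (b := n) (by omega)
  have hj := Int.emod_add_mul_ediv j n
  have hv := resIdx_val hn j
  have hins : ∀ k : Fin n, ∑ i ∈ Finset.Iio k, ξ i + ξ k = ∑ i ∈ Finset.Iic k, ξ i := by
    intro k
    rw [← Finset.Iio_insert, Finset.sum_insert (by simp), add_comm]
  by_cases h : j % n + 1 < n
  · have hm : (j + 1) % n = j % n + 1 := by
      rw [← Int.emod_add_emod, Int.emod_eq_of_lt (by omega) h]
    have hd : (j + 1) / n = j / n := by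
      have h2 := Int.emod_add_mul_ediv (j + 1) n
      rw [hm] at h2
      have h3 : (n : ℤ) * ((j + 1) / n) = n * (j / n) := by linarith
      exact mul_left_cancel₀ (by exact_mod_cast hn) h3
    have hset : Finset.Iio (resIdx hn (j + 1)) = Finset.Iic (resIdx hn j) := by
      ext i
      have hv' := resIdx_val hn (j + 1)
      simp only [Finset.mem_Iio, Finset.mem_Iic, Fin.lt_def, Fin.le_def]
      omega
    rw [liftAngle, liftAngle, hd, halfAngle, halfAngle, hset, ← hins]
    ring
  · have hm : (j + 1) % n = 0 := by
      rw [← Int.emod_add_emod, show j % n + 1 = n by omega, Int.emod_self]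
    have hd : (j + 1) / n = j / n + 1 := by
      have h2 := Int.emod_add_mul_ediv (j + 1) n
      rw [hm] at h2
      have h3 : (n : ℤ) * ((j + 1) / n) = n * (j / n + 1) := by
        rw [mul_add, mul_one]; omega
      exact mul_left_cancel₀ (by exact_mod_cast hn) h3
    have hset : Finset.Iio (resIdx hn (j + 1)) = ∅ := by
      ext i
      have hv' := resIdx_val hn (j + 1)
      simp only [Finset.mem_Iio, Fin.lt_def, Finset.notMem_empty, iff_false]
      omega
    have hset' : Finset.Iic (resIdx hn j) = Finset.univ := by
      ext i
      have := i.isLt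
      simp only [Finset.mem_Iic, Fin.le_def, Finset.mem_univ, iff_true]
      omega
    have h4 := hins (resIdx hn j)
    rw [hset', hξ] at h4
    rw [liftAngle, liftAngle, hd, halfAngle, halfAngle, hset, ← h4]
    push_cast
    simp only [Finset.sum_empty]
    ring

theorem liftAngle_monotone (hn : n ≠ 0) {ξ : Fin n → ℝ} (hξ : ξ ∈ alcove n) :
    Monotone (liftAngle hn ξ) :=
  monotone_int_of_le_succ fun j => by
    rw [liftAngle_add_one hn hξ.1]
    linarith [hξ.2 (resIdx hn j)]

/-- Increasing κ by one adds a telescoping sum over one period, which equals π. This fixes the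
average of θ_{j+κ} - θ_j at κπ/n. -/
theorem sum_liftAngle_sub (hn : n ≠ 0) (ξ : Fin n → ℝ) (κ : ℕ) :
    ∑ i ∈ Finset.range n, (liftAngle hn ξ (i + κ) - liftAngle hn ξ i) = κ * Real.pi := by
  induction κ with
  | zero => simp
  | succ κ ih =>
    have h1 : ∑ i ∈ Finset.range n,
        (liftAngle hn ξ (((i + 1 : ℕ) : ℤ) + κ) - liftAngle hn ξ (i + κ)) = Real.pi := by
      rw [Finset.sum_range_sub fun i : ℕ => liftAngle hn ξ (i + κ)]
      have := liftAngle_add_mul hn ξ κ 1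
      rw [one_mul, Int.cast_one, one_mul, add_comm] at this
      rw [this]
      simp
    calc ∑ i ∈ Finset.range n, (liftAngle hn ξ (i + (κ + 1 : ℕ)) - liftAngle hn ξ i)
        = ∑ i ∈ Finset.range n,
            (liftAngle hn ξ (((i + 1 : ℕ) : ℤ) + κ) - liftAngle hn ξ (i + κ))
          + ∑ i ∈ Finset.range n, (liftAngle hn ξ (i + κ) - liftAngle hn ξ i) := by
          rw [← Finset.sum_add_distrib]
          refine Finset.sum_congr rfl fun i _ => ?_
          rw [show ((i + 1 : ℕ) : ℤ) + κ = i + (κ + 1 : ℕ) by push_cast; ring]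
          ring
      _ = _ := by rw [h1, ih]; push_cast; ring

theorem cos_le_cos_of_mem_Icc {γ t : ℝ} (h0 : 0 ≤ γ) (h1 : γ ≤ t) (h2 : t ≤ 2 * Real.pi - γ) :
    Real.cos t ≤ Real.cos γ := by
  by_cases h : t ≤ Real.pi
  · exact Real.cos_le_cos_of_nonneg_of_le_pi h0 h h1
  · rw [← Real.cos_two_pi_sub t]
    exact Real.cos_le_cos_of_nonneg_of_le_pi h0 (by linarith) (by linarith)

/-- Interlacing of the spectra of `B` and `e^{2iy}B` for a pair in the fibre over `μ₀(y)`. -/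
theorem interlacing (hn : n ≠ 0) {y : ℝ} {A B : SU n} (hAB : commMap n (A, B) = muZero n y)
    {ξ : Fin n → ℝ} (hξ : ξ ∈ alcove n)
    (hconj : IsConj (B : Matrix (Fin n) (Fin n) ℂ) (delta n ξ)) (κ i j : ℤ)
    (hj : liftAngle hn ξ j + y < liftAngle hn ξ (j + κ))
    (hi : liftAngle hn ξ (i + κ) < liftAngle hn ξ i + y) : False := by
  have hn0 : (0 : ℤ) < n := by omega
  -- Both hypotheses survive shifts of i by multiples of n, and i ≡ j modulo n would make them
  -- contradict each other.
  wlog hij : j < i ∧ i < j + n generalizing i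
  · have h1 := Int.emod_nonneg (i - j) hn0.ne'
    have h2 := Int.emod_lt_of_pos (i - j) hn0
    have h3 := Int.emod_add_mul_ediv (i - j) n
    set m := (i - j) / (n : ℤ)
    have hm : (i - j) % n = i + -m * n - j := by linarith
    have hi' : liftAngle hn ξ (i + -m * n + κ) < liftAngle hn ξ (i + -m * n) + y := by
      rw [add_right_comm, liftAngle_add_mul, liftAngle_add_mul]
      linarith
    refine this (i + -m * n) hi' ⟨?_, by omega⟩
    rcases h1.lt_or_eq with h | h
    · omega
    · rw [show i + -m * n = j by omega] at hi'
      linarith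
  set θ := liftAngle hn ξ with hθ
  have hmono := liftAngle_monotone hn hξ
  set d : Fin n → ℂ := fun k => circ (halfAngle n ξ k) with hd
  have hBu := coe_mul_conjTranspose B
  have hAu := coe_mul_conjTranspose A
  have hchar : (B : Matrix (Fin n) (Fin n) ℂ).charpoly = (diagonal d).charpoly := by
    obtain ⟨c, hc⟩ := hconj
    rw [delta_eq] at hc
    have h1 : diagonal d = c.val * (B : Matrix (Fin n) (Fin n) ℂ) * c⁻¹.val := by
      rw [hc.eq, mul_assoc, Units.mul_inv, mul_one]
    rw [h1, charpoly_conj c.inv_mul]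
  obtain ⟨P, hP, hP', hBP⟩ := unitary_diagonalization_of_charpoly hBu hchar
  set Q := (A : Matrix (Fin n) (Fin n) ℂ) * P with hQ
  have hQQ : Q * Qᴴ = 1 := by
    rw [hQ, conjTranspose_mul, mul_assoc, ← mul_assoc P, hP, one_mul, hAu]
  have hcomm : Q * diagonal d * Qᴴ = diagonal (muZeroEntry n y) * B := by
    rw [commMap_eq_iff, coe_muZero] at hAB
    have : (A : Matrix (Fin n) (Fin n) ℂ) * B * (A : Matrix (Fin n) (Fin n) ℂ)ᴴ
        = Q * diagonal d * Qᴴ := by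
      conv_lhs => rw [hBP]
      rw [hQ, conjTranspose_mul]
      simp only [mul_assoc]
    rw [← this, hAB, mul_assoc, hAu, mul_one]
  have hU : P * diagonal (fun k => circ y * d k) * Pᴴ
      = circ y • (B : Matrix (Fin n) (Fin n) ℂ) := by
    have : diagonal (fun k => circ y * d k) = circ y • diagonal d := by
      rw [← diagonal_smul]; rfl
    rw [this, mul_smul_comm, smul_mul_assoc, ← hBP]
  let last : Fin n := ⟨n - 1, by omega⟩
  set α := θ j + y with hα
  set β := θ i + y with hβ
  have hαβ : α < β := by
    have : θ (j + κ) ≤ θ (i + κ) := hmono (by omega)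
    linarith
  have hθn : θ (j + n) = θ j + Real.pi := by
    have := liftAngle_add_mul hn ξ j 1
    simpa using this
  have hβα : β ≤ α + Real.pi := by
    have : θ i ≤ θ (j + n) := hmono hij.2.le
    linarith
  have hre : ∀ x, (-circ (-((α + β) / 2)) * circ x).re = -Real.cos (2 * x - (α + β)) := by
    intro x
    rw [neg_mul, ← circ_add, Complex.neg_re, re_circ]
    ring_nf
  -- The open arc (α, β) contains the n-independent block of i - j + 1 eigenvalues θ_{j+κ}, ...,
  -- θ_{i+κ} of μ₀(y)B, and the complementary closed arc contains the j + n - i + 1 eigenvalues θ_i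
  -- + y, ..., θ_{j+n} + y of qB: one more in total than allowed. The factor c rotates the midpoint
  -- of (α, β) to -1, so that the two arcs are separated by a bound on the real part.
  have key := card_add_card_le_of_eq_on_hyperplane (P := P) (Q := Q) hP hQQ
    (u := fun k => circ y * d k) (v := d) (w := (B : Matrix (Fin n) (Fin n) ℂ) last)
    (S := (Finset.Icc i (j + n)).image (resIdx hn))
    (T := (Finset.Icc (j + κ) (i + κ)).image (resIdx hn))
    (c := -circ (-((α + β) / 2))) (a := -Real.cos (β - α)) ?_ ?_ ?_
  · rw [Finset.card_image_of_injOn (resIdx_injOn hn (by omega)),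
      Finset.card_image_of_injOn (resIdx_injOn hn (by omega)), Int.card_Icc, Int.card_Icc] at key
    omega
  · intro x hx
    have hx' : ((B : Matrix (Fin n) (Fin n) ℂ) *ᵥ x) last = 0 := hx
    rw [hU, hcomm, ← mulVec_mulVec, smul_mulVec]
    funext k
    rw [mulVec_diagonal, Pi.smul_apply, smul_eq_mul, muZeroEntry_eq]
    split_ifs with hk
    · rw [show k = last from Fin.ext (by simp only [last]; omega), hx']; simp
    · rw [mul_one]
  · intro k hk
    obtain ⟨m, hm, rfl⟩ := Finset.mem_image.1 hk
    rw [Finset.mem_Icc] at hm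
    have h1 : θ i ≤ θ m := hmono hm.1
    have h2 : θ m ≤ θ (j + n) := hmono hm.2
    simp only [hd]
    rw [← circ_liftAngle, ← circ_add, hre, neg_le_neg_iff]
    apply cos_le_cos_of_mem_Icc <;> linarith
  · intro k hk
    obtain ⟨m, hm, rfl⟩ := Finset.mem_image.1 hk
    rw [Finset.mem_Icc] at hm
    have h1 : θ (j + κ) ≤ θ m := hmono hm.1
    have h2 : θ m ≤ θ (i + κ) := hmono hm.2
    simp only [hd]
    rw [← circ_liftAngle, hre, neg_lt_neg_iff, ← Real.cos_abs (2 * _ - _)]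
    apply Real.cos_lt_cos_of_nonneg_of_le_pi (abs_nonneg _) (by linarith)
    rw [abs_lt]
    constructor <;> linarith

theorem liftAngle_add_mul_ge {hn : n ≠ 0} {ξ : Fin n → ℝ} {κ : ℤ} {y : ℝ}
    (h : ∀ j, liftAngle hn ξ j + y ≤ liftAngle hn ξ (j + κ)) (j : ℤ) (s : ℕ) :
    liftAngle hn ξ j + s * y ≤ liftAngle hn ξ (j + s * κ) := by
  induction s with
  | zero => simp
  | succ s ih =>
    have := h (j + s * κ)
    rw [show j + ((s + 1 : ℕ) : ℤ) * κ = j + s * κ + κ by push_cast; ring]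
    push_cast
    linarith

theorem liftAngle_add_mul_le {hn : n ≠ 0} {ξ : Fin n → ℝ} {κ : ℤ} {y : ℝ}
    (h : ∀ j, liftAngle hn ξ (j + κ) ≤ liftAngle hn ξ j + y) (j : ℤ) (s : ℕ) :
    liftAngle hn ξ (j + s * κ) ≤ liftAngle hn ξ j + s * y := by
  induction s with
  | zero => simp
  | succ s ih =>
    have := h (j + s * κ)
    rw [show j + ((s + 1 : ℕ) : ℤ) * κ = j + s * κ + κ by push_cast; ring]
    push_cast
    linarith

/-- To the left of `κ/n`, the gaps in the spectrum of `B` are bounded below. -/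
theorem alcoveReg_of_lt (hn : n ≠ 0) {y : ℝ} {A B : SU n}
    (hAB : commMap n (A, B) = muZero n y) {ξ : Fin n → ℝ} (hξ : ξ ∈ alcove n)
    (hconj : IsConj (B : Matrix (Fin n) (Fin n) ℂ) (delta n ξ)) {κ s l : ℕ}
    (hs : s * κ = 1 + l * n) (hy : n * y < κ * Real.pi) (hy' : l * Real.pi < s * y) :
    ξ ∈ alcoveReg n := by
  refine ⟨hξ.1, fun k => ?_⟩
  -- One difference below y would, by `interlacing`, exclude differences above y, yet the average
  -- κπ/n exceeds y.
  have hall : ∀ j, liftAngle hn ξ j + y ≤ liftAngle hn ξ (j + κ) := by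
    by_contra! h
    obtain ⟨i, hi⟩ := h
    have hsum := sum_liftAngle_sub hn ξ κ
    have hlt : ∑ _i ∈ Finset.range n, y
        < ∑ i ∈ Finset.range n, (liftAngle hn ξ (i + κ) - liftAngle hn ξ i) := by
      rw [hsum, Finset.sum_const, Finset.card_range, nsmul_eq_mul]
      exact hy
    obtain ⟨j, -, hj⟩ := Finset.exists_lt_of_sum_lt hlt
    exact interlacing hn hAB hξ hconj κ i j (by linarith) hi
  have h1 := liftAngle_add_mul_ge hall (k : ℕ) s
  have h2 : ((k : ℕ) : ℤ) + s * κ = ((k : ℕ) : ℤ) + 1 + l * n := by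
    have : (s : ℤ) * κ = 1 + l * n := by exact_mod_cast hs
    rw [this]; ring
  rw [h2, liftAngle_add_mul, liftAngle_add_one hn hξ.1, resIdx_natCast, Int.cast_natCast] at h1
  linarith

/-- To the right of `κ/n`, the gaps in the spectrum of `B` are bounded below. -/
theorem alcoveReg_of_gt (hn : n ≠ 0) {y : ℝ} {A B : SU n}
    (hAB : commMap n (A, B) = muZero n y) {ξ : Fin n → ℝ} (hξ : ξ ∈ alcove n)
    (hconj : IsConj (B : Matrix (Fin n) (Fin n) ℂ) (delta n ξ)) {κ s l : ℕ}
    (hs : s * κ + 1 = l * n) (hy : κ * Real.pi < n * y) (hy' : s * y < l * Real.pi) :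
    ξ ∈ alcoveReg n := by
  refine ⟨hξ.1, fun k => ?_⟩
  have hall : ∀ j, liftAngle hn ξ (j + κ) ≤ liftAngle hn ξ j + y := by
    by_contra! h
    obtain ⟨j, hj⟩ := h
    have hsum := sum_liftAngle_sub hn ξ κ
    have hlt : ∑ i ∈ Finset.range n, (liftAngle hn ξ (i + κ) - liftAngle hn ξ i)
        < ∑ _i ∈ Finset.range n, y := by
      rw [hsum, Finset.sum_const, Finset.card_range, nsmul_eq_mul]
      exact hy
    obtain ⟨i, -, hi⟩ := Finset.exists_lt_of_sum_lt hlt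
    exact interlacing hn hAB hξ hconj κ i j hj (by linarith)
  have h1 := liftAngle_add_mul_le hall ((k : ℕ) + 1) s
  have h2 : ((k : ℕ) : ℤ) + 1 + s * κ = ((k : ℕ) : ℤ) + l * n := by
    have : (s : ℤ) * κ + 1 = l * n := by exact_mod_cast hs
    rw [← this]; ring
  rw [h2, liftAngle_add_mul, liftAngle_add_one hn hξ.1, resIdx_natCast, Int.cast_natCast] at h1
  linarith

/-! ### Farey neighbours of κ/n and type (i) -/

theorem torusDomain_eq_univ {y : ℝ}
    (h : ∀ A B : SU n, commMap n (A, B) = muZero n y → Xi B ∈ alcoveReg n) :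
    torusDomain n y = Set.univ := by
  rw [Set.eq_univ_iff_forall]
  intro x
  induction x using Quotient.inductionOn with
  | h p => exact h p.1.1 p.1.2 p.2

/-- For e/f strictly between, f = b(cf - ed) + d(eb - af) ≥ b + d > n. -/
theorem fareyNeighbours_of_unimodular {a b c d : ℕ} (hb : 1 ≤ b) (hbn : b ≤ n) (hd : 1 ≤ d)
    (hdn : d ≤ n) (hab : a ≤ b) (hcd : c ≤ d) (hdet : c * b = a * d + 1) (hbd : n < b + d) :
    FareyNeighbours n (a / b) (c / d) := by
  have hb' : (0 : ℝ) < b := by exact_mod_cast hb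
  have hd' : (0 : ℝ) < d := by exact_mod_cast hd
  refine ⟨div_mem_farey hb hbn hab, div_mem_farey hd hdn hcd, ?_, ?_⟩
  · rw [div_lt_div_iff₀ hb' hd']
    have : (c : ℝ) * b = a * d + 1 := by exact_mod_cast hdet
    linarith
  · rintro _ ⟨e, f, hf, hfn, -, -, rfl⟩ ⟨h1, h2⟩
    have hf' : (0 : ℝ) < f := by exact_mod_cast hf
    rw [div_lt_div_iff₀ hb' hf'] at h1
    rw [div_lt_div_iff₀ hf' hd'] at h2
    have h1' : a * f + 1 ≤ e * b := by exact_mod_cast h1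
    have h2' : e * d + 1 ≤ c * f := by exact_mod_cast h2
    have h3 : b + d ≤ f := by
      zify at *
      nlinarith
    omega

/-- The intervals adjacent to `κ/n` are of type (i). -/
theorem exists_neighbours_typeI (hn : 2 ≤ n) {κ : ℕ} (hκn : κ ≤ n - 1)
    (hcop : Nat.Coprime κ n) :
    ∃ p q : ℝ, FareyNeighbours n p ((κ : ℝ) / (n : ℝ)) ∧
      FareyNeighbours n ((κ : ℝ) / (n : ℝ)) q ∧
      IntervalTypeI n p ((κ : ℝ) / (n : ℝ)) ∧ IntervalTypeI n ((κ : ℝ) / (n : ℝ)) q := by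
  have hn0 : n ≠ 0 := by omega
  have hpi := Real.pi_pos
  have hnR : (0 : ℝ) < n := by exact_mod_cast Nat.pos_of_ne_zero hn0
  -- The inverse s of κ modulo n, with sκ = 1 + ln, gives the left neighbour l/s; the right one is
  -- (κ - l)/(n - s).
  obtain ⟨s, hsn, hs⟩ : ∃ s < n, κ * s % n = 1 := by
    obtain ⟨m, hm⟩ := Nat.exists_mul_mod_eq_one_of_coprime hcop (by omega)
    exact ⟨m, hm.1, hm.2⟩
  have hs1 : 1 ≤ s := by
    rw [Nat.one_le_iff_ne_zero]
    rintro rfl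
    simp at hs
  obtain ⟨l, hl⟩ : ∃ l, s * κ = 1 + l * n :=
    ⟨κ * s / n, by rw [← hs, mul_comm s, mul_comm (_ / _)]; exact (Nat.mod_add_div _ _).symm⟩
  have hlκ : l < κ := by
    by_contra! h
    have h1 : κ * n ≤ l * n := Nat.mul_le_mul_right _ h
    have h2 : s * κ ≤ n * κ := Nat.mul_le_mul_right _ hsn.le
    nlinarith
  have hls : l < s := by
    by_contra! h
    have h1 : s * n ≤ l * n := Nat.mul_le_mul_right _ h
    have h2 : s * κ ≤ s * n := Nat.mul_le_mul_left _ (by omega)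
    omega
  obtain ⟨l', hl'⟩ := Nat.exists_eq_add_of_lt hlκ
  obtain ⟨s', hs'⟩ := Nat.exists_eq_add_of_lt hsn
  have hdet' : (s' + 1) * κ + 1 = (l' + 1) * n := by
    zify at *
    have e1 : (s' : ℤ) + 1 = n - s := by linarith
    have e2 : (l' : ℤ) + 1 = κ - l := by linarith
    rw [e1, e2]
    linarith
  have hL := fareyNeighbours_of_unimodular (n := n) (a := l) (b := s) (c := κ) (d := n) hs1 hsn.le
    (by omega) le_rfl hls.le (by omega) (by rw [mul_comm κ, hl]; ring) (by omega)
  have hR := fareyNeighbours_of_unimodular (n := n) (a := κ) (b := n) (c := l' + 1) (d := s' + 1)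
    (by omega) le_rfl (by omega) (by omega) (by omega)
    (by
      by_contra! h
      have : (s' + 2) * n ≤ (l' + 1) * n := Nat.mul_le_mul_right _ (by omega)
      have : (s' + 1) * κ ≤ (s' + 1) * (n - 1) := Nat.mul_le_mul_left _ (by omega)
      zify [show 1 ≤ n by omega] at *
      nlinarith) (by rw [← hdet']; ring) (by omega)
  refine ⟨_, _, hL, hR, fun y hy => ⟨isAdmissible_of_neighbours hn hL hy, ?_⟩,
    fun y hy => ⟨isAdmissible_of_neighbours hn hR hy, ?_⟩⟩
  · refine torusDomain_eq_univ fun A B hAB => ?_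
    obtain ⟨h1, h2⟩ := Xi_spec hn0 B
    refine alcoveReg_of_lt hn0 hAB h1 h2 hl ?_ ?_
    · have := hy.2
      rw [div_lt_div_iff₀ hpi hnR] at this
      linarith
    · have := hy.1
      rw [div_lt_div_iff₀ (by exact_mod_cast hs1) hpi] at this
      linarith
  · refine torusDomain_eq_univ fun A B hAB => ?_
    obtain ⟨h1, h2⟩ := Xi_spec hn0 B
    refine alcoveReg_of_gt hn0 hAB h1 h2 hdet' ?_ ?_
    · have := hy.1
      rw [div_lt_div_iff₀ hnR hpi] at this
      linarith
    · have := hy.2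
      rw [div_lt_div_iff₀ hpi (by positivity)] at this
      linarith

/-! ### The two-weight interlacing problem -/

theorem circ_sub_circ (x y : ℝ) : circ x - circ y
    = 2 * Complex.I * Real.sin (x - y) * Complex.exp (Complex.I * (x + y)) := by
  rw [Complex.ofReal_sin, Complex.sin, circ, circ,
    show 2 * Complex.I * (x : ℂ) = ((x - y : ℝ) : ℂ) * Complex.I + Complex.I * (x + y) by
      push_cast; ring,
    show 2 * Complex.I * (y : ℂ) = -((x - y : ℝ) : ℂ) * Complex.I + Complex.I * (x + y) by
      push_cast; ring, Complex.exp_add, Complex.exp_add]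
  linear_combination (Complex.exp (((x - y : ℝ) : ℂ) * Complex.I)
    - Complex.exp (-((x - y : ℝ) : ℂ) * Complex.I)) * Complex.exp (Complex.I * (x + y))
    * Complex.I_mul_I

/-- The trigonometric form of the equation for the weight t at e^{2iX}: it is what (z - 1)(z -
e^{2i(X+Y-N)}) gives on evaluation at z = e^{2iX}, one of the two perturbed eigenvalues. -/
theorem circ_residue {X Y N t : ℝ}
    (h : t * (Real.sin N * Real.sin (X - Y)) = Real.sin X * Real.sin (N - Y)) :
    (t : ℂ) * ((circ (-N) - 1) * (circ X - circ Y)) = (1 - circ X) * (1 - circ (Y - N)) := by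
  rw [← circ_zero, circ_sub_circ, circ_sub_circ, circ_sub_circ, circ_sub_circ]
  have h' : (t : ℂ) * (Real.sin N * Real.sin (X - Y)) = Real.sin X * Real.sin (N - Y) := by
    exact_mod_cast h
  have e1 : Real.sin (-N - 0) = -Real.sin N := by rw [sub_zero, Real.sin_neg]
  have e2 : Real.sin (0 - X) = -Real.sin X := by rw [zero_sub, Real.sin_neg]
  have e3 : Real.sin (0 - (Y - N)) = Real.sin (N - Y) := by rw [zero_sub, neg_sub]
  have e4 : Complex.exp (Complex.I * ((-N : ℝ) + (0 : ℝ))) * Complex.exp (Complex.I * (X + Y))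
      = Complex.exp (Complex.I * ((0 : ℝ) + X))
        * Complex.exp (Complex.I * ((0 : ℝ) + (Y - N : ℝ))) := by
    rw [← Complex.exp_add, ← Complex.exp_add]
    push_cast
    ring_nf
  rw [e1, e2, e3]
  push_cast at h' e4 ⊢
  linear_combination (-(2 * Complex.I) ^ 2) * Complex.exp (Complex.I * (-N + 0))
    * Complex.exp (Complex.I * (X + Y)) * h' - (2 * Complex.I) ^ 2 * Complex.sin X
    * Complex.sin (N - Y) * e4

/-- The weights solving the two by two interlacing problem are nonnegative. -/
theorem exists_weight {X Y N ε η σ : ℝ} {a c l : ℤ} (hX : X = ε + a * Real.pi)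
    (hY : Y = -η + c * Real.pi) (hK : X + Y - N = σ + l * Real.pi) (hε : 0 < ε) (hη : 0 < η)
    (hεσ : ε < σ) (hση : σ + η < Real.pi) :
    ∃ t : ℝ, 0 ≤ t ∧ t ≤ 1 ∧
      t * (Real.sin N * Real.sin (X - Y)) = Real.sin X * Real.sin (N - Y) := by
  have s1 : 0 < Real.sin ε := Real.sin_pos_of_pos_of_lt_pi hε (by linarith)
  have s2 : 0 < Real.sin (σ - ε) := Real.sin_pos_of_pos_of_lt_pi (by linarith) (by linarith)
  have s3 : 0 < Real.sin (σ + η - ε) := Real.sin_pos_of_pos_of_lt_pi (by linarith) (by linarith)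
  have s4 : 0 < Real.sin (ε + η) := Real.sin_pos_of_pos_of_lt_pi (by linarith) (by linarith)
  have s5 : 0 < Real.sin η := Real.sin_pos_of_pos_of_lt_pi hη (by linarith)
  have s6 : 0 < Real.sin (η + σ) := Real.sin_pos_of_pos_of_lt_pi (by linarith) (by linarith)
  -- Divided by the right side, this reads t + (1 - t) = 1 with both summands visibly positive.
  have hid : Real.sin ε * Real.sin (σ - ε) + Real.sin η * Real.sin (η + σ)
      = Real.sin (σ + η - ε) * Real.sin (ε + η) := by
    have h1 := Real.two_mul_sin_mul_sin ε (σ - ε)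
    have h2 := Real.two_mul_sin_mul_sin η (η + σ)
    have h3 := Real.two_mul_sin_mul_sin (σ + η - ε) (ε + η)
    rw [show ε - (σ - ε) = -(σ + η - ε - (ε + η)) by ring, Real.cos_neg,
      show ε + (σ - ε) = σ by ring] at h1
    rw [show η - (η + σ) = -σ by ring, Real.cos_neg,
      show η + (η + σ) = σ + η - ε + (ε + η) by ring] at h2
    linarith
  refine ⟨Real.sin ε * Real.sin (σ - ε) / (Real.sin (σ + η - ε) * Real.sin (ε + η)),
    by positivity, ?_, ?_⟩
  · rw [div_le_one (by positivity), ← hid]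
    nlinarith
  · have hN : Real.sin N = (-1) ^ (a + c - l) * -Real.sin (σ + η - ε) := by
      rw [show N = -(σ + η - ε) + (a + c - l : ℤ) * Real.pi by push_cast; linarith,
        Real.sin_add_int_mul_pi, Real.sin_neg]
    have hXY : Real.sin (X - Y) = (-1) ^ (a - c) * Real.sin (ε + η) := by
      rw [show X - Y = ε + η + (a - c : ℤ) * Real.pi by push_cast; linarith,
        Real.sin_add_int_mul_pi]
    have hNY : Real.sin (N - Y) = (-1) ^ (a - l) * -Real.sin (σ - ε) := by
      rw [show N - Y = -(σ - ε) + (a - l : ℤ) * Real.pi by push_cast; linarith,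
        Real.sin_add_int_mul_pi, Real.sin_neg]
    have hXs : Real.sin X = (-1) ^ a * Real.sin ε := by rw [hX, Real.sin_add_int_mul_pi]
    have hsign : (-1 : ℝ) ^ (a + c - l) * (-1) ^ (a - c) = (-1) ^ a * (-1) ^ (a - l) := by
      rw [← zpow_add₀ (by norm_num), ← zpow_add₀ (by norm_num)]
      congr 1
      ring
    rw [hN, hXY, hNY, hXs]
    field_simp
    linear_combination -hsign

/-! ### Rank one perturbations conjugate to μ₀(y) -/

theorem charpoly_eq_of_eval {U V : Matrix (Fin n) (Fin n) ℂ} (s : Finset ℂ)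
    (h : ∀ z ∉ s, U.charpoly.eval z = V.charpoly.eval z) : U.charpoly = V.charpoly := by
  refine Polynomial.eq_of_infinite_eval_eq _ _ ?_
  exact (s.finite_toSet.infinite_compl).mono fun z hz => h z hz

theorem eval_charpoly_diagonal_add {a u w : Fin n → ℂ} {z : ℂ} (hz : ∀ i, z - a i ≠ 0) :
    (diagonal a + vecMulVec u w).charpoly.eval z
      = (∏ i, (z - a i)) * (1 - ∑ i, w i * u i / (z - a i)) := by
  rw [eval_charpoly, ← det_diagonal_sub_vecMulVec hz, scalar_apply, ← sub_sub, diagonal_sub]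

theorem eval_charpoly_diagonal (a : Fin n → ℂ) (z : ℂ) :
    (diagonal a).charpoly.eval z = ∏ i, (z - a i) := by
  rw [charpoly_diagonal, eval_prod]
  simp

/-- `q (1 + (q⁻ⁿ - 1) v vᵀ)`, a conjugate of `μ₀(y)` for `q = e^{2iy}` and a real unit vector
`v`. -/
def muOf (y : ℝ) (v : Fin n → ℝ) : Matrix (Fin n) (Fin n) ℂ :=
  circ y • (1 + (circ (-(n * y)) - 1) • vecMulVec (fun i => (v i : ℂ)) fun i => (v i : ℂ))

theorem muOf_mul_diagonal (y : ℝ) (v : Fin n → ℝ) (d : Fin n → ℂ) :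
    muOf y v * diagonal d = diagonal (fun i => circ y * d i)
      + vecMulVec (fun i => circ y * (circ (-(n * y)) - 1) * v i) fun i => v i * d i := by
  ext i j
  rw [mul_diagonal, muOf, Matrix.smul_apply, Matrix.add_apply, Matrix.add_apply,
    Matrix.smul_apply, vecMulVec_apply, vecMulVec_apply, diagonal_apply, one_apply]
  simp only [smul_eq_mul]
  split_ifs with h
  · subst h; ring
  · ring

theorem muOf_mul_conjTranspose (y : ℝ) {v : Fin n → ℝ} (hv : ∑ i, v i ^ 2 = 1) :
    muOf y v * (muOf y v)ᴴ = 1 := by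
  set w : Fin n → ℂ := fun i => (v i : ℂ) with hw
  set s : ℂ := circ (-(n * y)) - 1 with hs
  have hws : star w = w := by
    funext i; simp [hw]
  have hww : w ⬝ᵥ w = 1 := by
    have : ((∑ i, v i ^ 2 : ℝ) : ℂ) = 1 := by rw [hv]; simp
    rw [dotProduct, ← this]
    push_cast
    exact Finset.sum_congr rfl fun i _ => (sq _).symm
  have hss : s + star s + s * star s = 0 := by
    have := circ_mul_star (-(n * y))
    rw [hs, star_sub, star_one]
    linear_combination this
  have hmu : muOf y v = circ y • (1 + s • vecMulVec w w) := rfl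
  rw [hmu, conjTranspose_smul, smul_mul_smul_comm, circ_mul_star, one_smul, conjTranspose_add,
    conjTranspose_one, conjTranspose_smul, conjTranspose_vecMulVec, hws, add_mul, mul_add, mul_add,
    one_mul, one_mul, mul_one, smul_mul_smul_comm, vecMulVec_mul_vecMulVec, hww, one_smul]
  calc _ = 1 + (s + star s + s * star s) • vecMulVec w w := by module
    _ = 1 := by rw [hss, zero_smul, add_zero]

/-- Away from z = e^{2iy} the rank one determinant formula applies with a constant diagonal, so only
the norm of v enters. -/
theorem charpoly_muOf (hn : n ≠ 0) (y : ℝ) {v : Fin n → ℝ} (hv : ∑ i, v i ^ 2 = 1) :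
    (muOf y v).charpoly = (diagonal (muZeroEntry n y)).charpoly := by
  refine charpoly_eq_of_eval {circ y} fun z hz => ?_
  have hz0 : z - circ y ≠ 0 := sub_ne_zero.2 (by simpa using hz)
  have h1 := muOf_mul_diagonal y v fun _ => 1
  rw [diagonal_one, mul_one] at h1
  simp only [mul_one] at h1
  let last : Fin n := ⟨n - 1, by omega⟩
  have hcond : ∀ k : Fin n, (k : ℕ) + 1 = n ↔ k = last := by
    intro k
    simp only [last, Fin.ext_iff]
    omega
  rw [h1, eval_charpoly_diagonal_add fun _ => hz0, eval_charpoly_diagonal]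
  have hprod : ∏ i, (z - muZeroEntry n y i) = (∏ _i : Fin n, (z - circ y))
      * ∏ i, if i = last then (z - circ y * circ (-(n * y))) / (z - circ y) else 1 := by
    rw [← Finset.prod_mul_distrib]
    refine Finset.prod_congr rfl fun i _ => ?_
    rw [muZeroEntry_eq]
    simp only [hcond]
    split_ifs
    · have : circ (-(n * y)) = (circ y ^ n)⁻¹ := by
        rw [← circ_nat_mul]
        exact eq_inv_of_mul_eq_one_left (by rw [← circ_add, neg_add_cancel, circ_zero])
      rw [mul_div_cancel₀ _ hz0, this]
    · simp
  rw [hprod, Finset.prod_ite_eq' Finset.univ last, if_pos (Finset.mem_univ _)]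
  congr 1
  rw [← Finset.sum_div]
  have hsum : ∑ i, (v i : ℂ) * (circ y * (circ (-(n * y)) - 1) * v i)
      = circ y * (circ (-(n * y)) - 1) := by
    have : ((∑ i, v i ^ 2 : ℝ) : ℂ) = 1 := by rw [hv]; simp
    push_cast at this
    calc ∑ i, (v i : ℂ) * (circ y * (circ (-(n * y)) - 1) * v i)
        = ∑ i, circ y * (circ (-(n * y)) - 1) * (v i : ℂ) ^ 2 :=
          Finset.sum_congr rfl fun i _ => by ring
      _ = _ := by rw [← Finset.mul_sum, this, mul_one]
  rw [hsum]
  field_simp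
  ring

/-! ### Isospectral perturbation of two overlapping strings -/

/-- The exponents of two strings `0, …, b - 1` and `k, k + 1, …`. -/
def stringExp (b k i : ℕ) : ℕ := if i < b then i else i - b + k

theorem prod_stringExp (b k m : ℕ) (f : ℕ → ℂ) :
    ∏ i : Fin (b + m), f (stringExp b k i)
      = (∏ i ∈ Finset.range b, f i) * ∏ i ∈ Finset.range m, f (i + k) := by
  rw [Fin.prod_univ_eq_prod_range (fun i => f (stringExp b k i)), Finset.prod_range_add]
  congr 1
  · refine Finset.prod_congr rfl fun i hi => ?_
    rw [stringExp, if_pos (Finset.mem_range.1 hi)]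
  · refine Finset.prod_congr rfl fun i _ => ?_
    rw [stringExp, if_neg (by omega), Nat.add_sub_cancel_left]

/-- A shift by one only affects string ends: the starts 0, k are lost and the ends b, m + k gained.
The cross-multiplied form avoids dividing by zeros of f. -/
theorem prod_stringExp_succ (b k m : ℕ) (f : ℕ → ℂ) :
    (∏ i : Fin (b + m), f (stringExp b k i + 1)) * (f 0 * f k)
      = (∏ i : Fin (b + m), f (stringExp b k i)) * (f b * f (m + k)) := by
  rw [prod_stringExp b k m f, prod_stringExp b k m fun i => f (i + 1)]
  have h1 := (Finset.prod_range_succ f b).symm.trans (Finset.prod_range_succ' f b)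
  have h2 := (Finset.prod_range_succ (fun i => f (i + k)) m).symm.trans
    (Finset.prod_range_succ' (fun i => f (i + k)) m)
  simp only [zero_add] at h2
  have h3 : ∀ i, f (i + k + 1) = f (i + 1 + k) := fun i => by rw [add_right_comm]
  simp only [h3]
  calc _ = ((∏ i ∈ Finset.range b, f (i + 1)) * f 0)
        * ((∏ i ∈ Finset.range m, f (i + 1 + k)) * f k) := by ring
    _ = _ := by rw [← h1, ← h2]; ring

/-- The union of two overlapping strings is isospectral to its perturbation by `muOf`, for suitable
weights at the two ends. -/
theorem charpoly_muOf_mul_strings {b k m : ℕ} (hb : 1 ≤ b) (hm : 1 ≤ m) {y t : ℝ}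
    (ht0 : 0 ≤ t) (ht1 : t ≤ 1)
    (ht : t * (Real.sin ((b + m : ℕ) * y) * Real.sin (b * y - (m + k : ℕ) * y))
      = Real.sin (b * y) * Real.sin ((b + m : ℕ) * y - (m + k : ℕ) * y)) :
    ∃ v : Fin (b + m) → ℝ, ∑ i, v i ^ 2 = 1 ∧
      (muOf y v * diagonal fun i : Fin (b + m) => circ y ^ stringExp b k i).charpoly
        = (diagonal fun i : Fin (b + m) => circ y ^ stringExp b k i).charpoly := by
  -- The last members of the two strings; v is supported there, with squared weights t and 1 - t.
  let i₁ : Fin (b + m) := ⟨b - 1, by omega⟩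
  let i₂ : Fin (b + m) := ⟨b + m - 1, by omega⟩
  have hne : i₁ ≠ i₂ := by
    simp only [i₁, i₂, ne_eq, Fin.ext_iff]
    omega
  let v : Fin (b + m) → ℝ := fun i => if i = i₁ then √t else if i = i₂ then √(1 - t) else 0
  have hv1 : v i₁ ^ 2 = t := by simp only [v, if_true]; exact Real.sq_sqrt ht0
  have hv2 : v i₂ ^ 2 = 1 - t := by
    simp only [v, if_neg hne.symm, if_true]; exact Real.sq_sqrt (by linarith)
  have hv0 : ∀ i, i ≠ i₁ ∧ i ≠ i₂ → v i = 0 := by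
    rintro i ⟨h1, h2⟩
    simp only [v, if_neg h1, if_neg h2]
  refine ⟨v, ?_, ?_⟩
  · rw [Fintype.sum_eq_add i₁ i₂ hne (fun i hi => by rw [hv0 i hi]; simp), hv1, hv2]
    ring
  set q := circ y with hq
  have hq0 : q ≠ 0 := circ_ne_zero y
  refine charpoly_eq_of_eval (Finset.univ.image fun i : Fin (b + m) => q * q ^ stringExp b k i) fun z hz => ?_
  have hz' : ∀ i : Fin (b + m), z - q * q ^ stringExp b k i ≠ 0 := by
    intro i h
    apply hz
    rw [Finset.mem_image]
    exact ⟨i, Finset.mem_univ _, (sub_eq_zero.1 h).symm⟩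
  have he1 : q * q ^ stringExp b k i₁ = q ^ b := by
    rw [← pow_succ', stringExp, if_pos (by simp only [i₁]; omega)]
    congr 1
    simp only [i₁]; omega
  have he2 : q * q ^ stringExp b k i₂ = q ^ (m + k) := by
    rw [← pow_succ', stringExp, if_neg (by simp only [i₂]; omega)]
    congr 1
    simp only [i₂]; omega
  have hz1 : z - q ^ b ≠ 0 := he1 ▸ hz' i₁
  have hz2 : z - q ^ (m + k) ≠ 0 := he2 ▸ hz' i₂
  rw [muOf_mul_diagonal, eval_charpoly_diagonal_add hz', eval_charpoly_diagonal,
    Fintype.sum_eq_add i₁ i₂ hne (fun i hi => by rw [hv0 i hi]; simp), ← hq, he1, he2]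
  set s := circ (-((b + m : ℕ) * y)) - 1 with hs
  have hv1' : (v i₁ : ℂ) ^ 2 = t := by rw [← hv1]; push_cast; rfl
  have hv2' : (v i₂ : ℂ) ^ 2 = 1 - t := by
    have : ((v i₂ ^ 2 : ℝ) : ℂ) = ((1 - t : ℝ) : ℂ) := by rw [hv2]
    push_cast at this
    exact this
  have t1 : (v i₁ : ℂ) * q ^ stringExp b k i₁ * (q * s * v i₁) = t * s * q ^ b := by
    rw [← he1, ← hv1']; ring
  have t2 : (v i₂ : ℂ) * q ^ stringExp b k i₂ * (q * s * v i₂) = (1 - t) * s * q ^ (m + k) := by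
    rw [← he2, ← hv2']; ring
  rw [t1, t2]
  have hshift := prod_stringExp_succ b k m fun i => z - q ^ i
  simp only [pow_succ', pow_zero] at hshift
  have hres := circ_residue ht
  have hd : circ ((m + k : ℕ) * y - (b + m : ℕ) * y) = (s + 1) * q ^ (m + k) := by
    rw [sub_eq_neg_add, circ_add, circ_nat_mul, hs]; ring
  rw [hd, circ_nat_mul, circ_nat_mul, ← hq, ← hs] at hres
  have hk : (s + 1) * q ^ (m + k) * q ^ b = q ^ k := by
    have h1 : (s + 1) * q ^ (b + m) = 1 := by
      rw [hq, ← circ_nat_mul, hs, sub_add_cancel, ← circ_add, neg_add_cancel, circ_zero]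
    calc (s + 1) * q ^ (m + k) * q ^ b = (s + 1) * q ^ (b + m) * q ^ k := by ring
      _ = _ := by rw [h1, one_mul]
  -- By `hk` both sides are monic quadratics with the same constant term; the weight equation `hres`
  -- matches the linear term.
  have hquad : (z - q ^ b) * (z - q ^ (m + k))
      * (1 - (t * s * q ^ b / (z - q ^ b) + (1 - t) * s * q ^ (m + k) / (z - q ^ (m + k))))
      = (z - 1) * (z - q ^ k) := by
    rw [← hk]
    field_simp
    linear_combination (-z) * hres
  have hne2 : (z - q ^ b) * (z - q ^ (m + k)) ≠ 0 := mul_ne_zero hz1 hz2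
  apply mul_left_cancel₀ hne2
  calc _ = (∏ i : Fin (b + m), (z - q * q ^ stringExp b k i)) * ((z - q ^ b) * (z - q ^ (m + k))
      * (1 - (t * s * q ^ b / (z - q ^ b)
        + (1 - t) * s * q ^ (m + k) / (z - q ^ (m + k))))) := by ring
    _ = _ := by rw [hquad, hshift]; ring

/-- A pair in the fibre over `μ₀(y)` whose second member has a degenerate spectrum, from an
isospectral rank one perturbation. -/
theorem torusDomain_ne_univ (hn : n ≠ 0) {y : ℝ} {v : Fin n → ℝ} (hv : ∑ i, v i ^ 2 = 1)
    {d : Fin n → ℂ} (hd : ∀ i, d i * star (d i) = 1)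
    (hchar : (muOf y v * diagonal d).charpoly = (diagonal d).charpoly)
    (hdeg : ¬ Function.Injective d) : torusDomain n y ≠ Set.univ := by
  have hM := muOf_mul_conjTranspose y hv
  have hD := diagonal_mul_conjTranspose hd
  have hMD : muOf y v * diagonal d * (muOf y v * diagonal d)ᴴ = 1 := by
    rw [conjTranspose_mul, mul_assoc, ← mul_assoc (diagonal d), hD, one_mul, hM]
  obtain ⟨g, hg⟩ := exists_SU_conj hn hM (coe_mul_conjTranspose (muZero n y))
    (charpoly_muOf hn y hv)
  obtain ⟨A, hA⟩ := exists_SU_conj hn hD hMD hchar.symm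
  -- Rescaling into SU(n) affects neither the commutator nor the repetition of eigenvalues.
  obtain ⟨c, hc, hcD⟩ := exists_smul_mem_SU hn hD
  let D : SU n := ⟨_, hcD⟩
  have hDval : (D : Matrix (Fin n) (Fin n) ℂ) = c • diagonal d := rfl
  have hAD : (A : Matrix (Fin n) (Fin n) ℂ) * D = muOf y v * D * A := by
    rw [hDval]
    simp only [mul_smul_comm, smul_mul_assoc, hA]
  have hgu : ((g⁻¹ : SU n) : Matrix (Fin n) (Fin n) ℂ) * g = 1 := by
    rw [coe_inv_eq, mul_eq_one_comm, coe_mul_conjTranspose]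
  have hcomm : commMap n (g * A * g⁻¹, g * D * g⁻¹) = muZero n y := by
    rw [commMap_eq_iff]
    set G := (g : Matrix (Fin n) (Fin n) ℂ)
    set G' := ((g⁻¹ : SU n) : Matrix (Fin n) (Fin n) ℂ)
    change G * A * G' * (G * D * G') = muZero n y * (G * D * G') * (G * A * G')
    calc G * A * G' * (G * D * G') = G * A * (G' * G) * D * G' := by simp only [mul_assoc]
      _ = G * (A * D) * G' := by rw [hgu, mul_one]; simp only [mul_assoc]
      _ = (G * muOf y v) * D * A * G' := by rw [hAD]; simp only [mul_assoc]
      _ = muZero n y * G * D * (G' * G) * A * G' := by rw [hg, hgu, mul_one]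
      _ = _ := by simp only [mul_assoc]
  intro huniv
  have hmem : (Quotient.mk (orbitSetoid n y) ⟨(g * A * g⁻¹, g * D * g⁻¹), hcomm⟩)
      ∈ torusDomain n y := by rw [huniv]; trivial
  have hreg : Xi (g * D * g⁻¹) ∈ alcoveReg n := hmem
  rw [Xi_conj] at hreg
  obtain ⟨u, hu⟩ := (Xi_spec hn D).2
  have hinj := circ_halfAngle_injective hreg
  rw [delta_eq] at hu
  have hDd : (D : Matrix (Fin n) (Fin n) ℂ) = diagonal (c • d) := by rw [hDval, ← diagonal_smul]
  have hch : (diagonal (c • d)).charpoly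
      = (diagonal fun k => circ (halfAngle n (Xi D) k)).charpoly := by
    have h1 : (diagonal fun k => circ (halfAngle n (Xi D) k))
        = u.val * (D : Matrix (Fin n) (Fin n) ℂ) * u⁻¹.val := by
      rw [hu.eq, mul_assoc, Units.mul_inv, mul_one]
    rw [h1, charpoly_conj u.inv_mul, hDd]
  obtain ⟨σ, hσ⟩ := exists_perm_of_charpoly_eq hch
  rw [← hσ] at hinj
  apply hdeg
  have h2 : Function.Injective (c • d) := by
    have := hinj.comp σ.symm.injective
    rwa [Function.comp_assoc, Equiv.self_comp_symm, Function.comp_id] at this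
  intro i j hij
  exact h2 (by rw [Pi.smul_apply, Pi.smul_apply, hij])

/-! ### Farey separation and type (ii) -/

theorem le_or_le_of_neighbours {p q : ℝ} (h : FareyNeighbours n p q) {j : ℕ} (hj : 1 ≤ j)
    (hjn : j ≤ n) (i : ℤ) : (i : ℝ) ≤ p * j ∨ q * j ≤ i := by
  obtain ⟨⟨a, b, hb, -, -, -, rfl⟩, ⟨c, d, hd, -, hcd, -, rfl⟩, -, hno⟩ := h
  have hj' : (0 : ℝ) < j := by exact_mod_cast hj
  -- Fractions i/j outside [0, 1] are not in the Farey sequence, but they cannot lie between p and q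
  -- either.
  rcases lt_or_ge i 0 with hi | hi
  · left
    have : (i : ℝ) < 0 := by exact_mod_cast hi
    exact this.le.trans (by positivity)
  rcases le_or_gt i j with hij | hij
  · lift i to ℕ using hi
    have := hno _ (div_mem_farey hj hjn (by exact_mod_cast hij))
    rw [not_and_or, not_lt, not_lt, div_le_iff₀ hj', le_div_iff₀ hj'] at this
    exact_mod_cast this
  · right
    have h1 : (c : ℝ) / d ≤ 1 := by
      rw [div_le_one (by positivity)]; exact_mod_cast hcd
    have h2 : (j : ℝ) < i := by exact_mod_cast hij
    nlinarith

/-- For Farey separated `a/b < y/r < c/d`, the fractional part of `ky/r` keeps away from zero by more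
than the distances of `by/r` and `dy/r` to `a` and `c`. -/
theorem exists_int_angle {a b c d k : ℕ} {y r : ℝ} (hpi : 0 < r)
    (hsep' : ∀ {j : ℕ}, 1 ≤ j → j ≤ n → ∀ i : ℤ, i * b ≤ a * j ∨ c * j ≤ i * d)
    (hcop : Nat.Coprime a b) (hcop' : Nat.Coprime c d) (hbn : b ≤ n) (hdn : d ≤ n)
    (hk1 : 1 ≤ k) (hkb : k < b) (hkd : k < d) (hy1 : a * r < b * y) (hy2 : d * y < c * r) :
    ∃ l : ℤ, b * y - a * r < k * y - l * r ∧ k * y - l * r + (c * r - d * y) < r := by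
  have hbR : (0 : ℝ) < b := by exact_mod_cast hk1.trans hkb.le
  have hdR : (0 : ℝ) < d := by exact_mod_cast hk1.trans hkd.le
  have hkR : (0 : ℝ) < k := by exact_mod_cast hk1
  set l := ⌊k * y / r⌋
  have hl1 : l * r ≤ k * y := by
    rw [← le_div_iff₀ hpi]; exact Int.floor_le _
  have hl2 : k * y < (l + 1) * r := by
    rw [← div_lt_iff₀ hpi]; exact Int.lt_floor_add_one _
  -- The fraction l/k is at most y/r < c/d, so separation puts it at or below a/b; equality would
  -- need b to divide k < b. Likewise (l + 1)/k lies above c/d.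
  have hlow : l * b < a * k := by
    refine lt_of_le_of_ne ?_ ?_
    · refine (hsep' hk1 (by omega) l).resolve_right fun h => ?_
      have h' : (c : ℝ) * k ≤ l * d := by exact_mod_cast h
      nlinarith [mul_le_mul_of_nonneg_right h' hpi.le, mul_le_mul_of_nonneg_left hl1 hdR.le,
        mul_lt_mul_of_pos_left hy2 hkR]
    · intro h
      have h1 : (b : ℤ) ∣ k := by
        have h2 : (b : ℤ) ∣ a * k := ⟨l, by rw [← h]; ring⟩
        exact IsCoprime.dvd_of_dvd_mul_left
          ((Nat.isCoprime_iff_coprime.2 hcop).symm) h2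
      have := Nat.le_of_dvd hk1 (by exact_mod_cast h1)
      omega
  have hupp : c * k < (l + 1) * d := by
    refine lt_of_le_of_ne ?_ ?_
    · refine (hsep' hk1 (by omega) (l + 1)).resolve_left fun h => ?_
      have h' : ((l : ℝ) + 1) * b ≤ a * k := by exact_mod_cast h
      nlinarith [mul_le_mul_of_nonneg_right h' hpi.le, mul_lt_mul_of_pos_left hl2 hbR,
        mul_lt_mul_of_pos_left hy1 hkR]
    · intro h
      have h1 : (d : ℤ) ∣ k := by
        have h2 : (d : ℤ) ∣ c * k := ⟨l + 1, by rw [h]; ring⟩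
        exact IsCoprime.dvd_of_dvd_mul_left
          ((Nat.isCoprime_iff_coprime.2 hcop').symm) h2
      have := Nat.le_of_dvd hk1 (by exact_mod_cast h1)
      omega
  -- The inequalities say (b - k)y < (a - l)r and (c - l - 1)r < (d - k)y. Separation applied to (a
  -- - l)/(b - k) and (c - l - 1)/(d - k) leaves two options each; `hlow` and `hupp` exclude the
  -- wrong one.
  refine ⟨l, ?_, ?_⟩
  · have hjb : ((b - k : ℕ) : ℤ) = b - k := Nat.cast_sub hkb.le
    rcases hsep' (j := b - k) (by omega) (by omega) (a - l) with h | h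
    · rw [hjb] at h
      linarith
    · rw [hjb] at h
      have h' : (c : ℝ) * (b - k) ≤ (a - l) * d := by exact_mod_cast h
      have hbk : (0 : ℝ) < b - k := by
        rw [sub_pos]; exact_mod_cast hkb
      have h3 : d * ((b - k) * y) < d * ((a - l) * r) := by
        nlinarith [mul_le_mul_of_nonneg_right h' hpi.le, mul_lt_mul_of_pos_left hy2 hbk]
      have := lt_of_mul_lt_mul_left h3 hdR.le
      linarith
  · have hjd : ((d - k : ℕ) : ℤ) = d - k := Nat.cast_sub hkd.le
    rcases hsep' (j := d - k) (by omega) (by omega) (c - l - 1) with h | h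
    · rw [hjd] at h
      have h' : ((c : ℝ) - l - 1) * b ≤ a * (d - k) := by exact_mod_cast h
      have hdk : (0 : ℝ) < d - k := by
        rw [sub_pos]; exact_mod_cast hkd
      have h3 : b * ((c - l - 1) * r) < b * ((d - k) * y) := by
        nlinarith [mul_le_mul_of_nonneg_right h' hpi.le, mul_lt_mul_of_pos_left hy1 hdk]
      have := lt_of_mul_lt_mul_left h3 hbR.le
      linarith
    · rw [hjd] at h
      linarith

/-- The other intervals between Farey neighbours are of type (ii). -/
theorem intervalTypeII_of_not_isSpecial (hn : 2 ≤ n) {p q : ℝ} (h : FareyNeighbours n p q)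
    (hp : ¬ IsSpecial n p) (hq : ¬ IsSpecial n q) : IntervalTypeII n p q := by
  intro y hy
  refine ⟨isAdmissible_of_neighbours hn h hy, ?_⟩
  have hsep := fun {j : ℕ} => le_or_le_of_neighbours h (j := j)
  obtain ⟨⟨a, b, hb, hbn, hab, hcop, rfl⟩, ⟨c, d, hd, hdn, hcd, hcop', rfl⟩, hpq, -⟩ := h
  have hpi := Real.pi_pos
  have hbR : (0 : ℝ) < b := by exact_mod_cast hb
  have hdR : (0 : ℝ) < d := by exact_mod_cast hd
  -- A reduced endpoint with denominator n ≥ 2 would be special, so both denominators are below n.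
  have hlt : ∀ e f : ℕ, e ≤ f → Nat.Coprime e f → f ≤ n → ¬ IsSpecial n ((e : ℝ) / f) →
      f < n := by
    intro e f hef hc hfn hs
    rcases hfn.lt_or_eq with h | rfl
    · exact h
    · exfalso
      have h0 : e ≠ 0 := by
        rintro rfl
        rw [Nat.coprime_zero_left] at hc
        omega
      have h1 : e ≠ f := by
        rintro rfl
        rw [Nat.coprime_self] at hc
        omega
      exact hs ⟨e, by omega, by omega, hc, rfl⟩
  have hbn' := hlt a b hab hcop hbn hp
  have hdn' := hlt c d hcd hcop' hdn hq
  have hy1 : a * Real.pi < b * y := by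
    have := hy.1
    rw [div_lt_div_iff₀ hbR hpi] at this
    linarith
  have hy2 : d * y < c * Real.pi := by
    have := hy.2
    rw [div_lt_div_iff₀ hpi hdR] at this
    linarith
  have hsep' : ∀ {j : ℕ}, 1 ≤ j → j ≤ n → ∀ i : ℤ, i * b ≤ a * j ∨ c * j ≤ i * d := by
    intro j hj hjn i
    rcases hsep hj hjn i with h | h
    · left
      rw [div_mul_eq_mul_div, le_div_iff₀ hbR] at h
      exact_mod_cast h
    · right
      rw [div_mul_eq_mul_div, div_le_iff₀ hdR] at h
      exact_mod_cast h
  have hdet : (a : ℤ) * d < c * b := by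
    rw [div_lt_div_iff₀ hbR hdR] at hpq
    exact_mod_cast hpq
  -- Otherwise the mediant (a + c)/(b + d) would be a Farey fraction strictly between the endpoints.
  have hbd : n < b + d := by
    by_contra! hle
    rcases hsep' (j := b + d) (by omega) hle (a + c) with h | h <;> push_cast at h <;> nlinarith
  obtain ⟨k, hk⟩ : ∃ k, b + d = n + k := ⟨b + d - n, by omega⟩
  obtain ⟨m, hm⟩ : ∃ m, n = b + m := ⟨n - b, by omega⟩
  have hk1 : 1 ≤ k := by omega
  have hkb : k < b := by omega
  have hkd : k < d := by omega
  have hdm : d = m + k := by omega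
  have hkR' : (d : ℝ) = m + k := by exact_mod_cast hdm
  obtain ⟨l, hεσ, hση⟩ := exists_int_angle hpi hsep' hcop hcop' hbn hdn hk1 hkb hkd hy1 hy2
  subst hm
  obtain ⟨t, ht0, ht1, ht⟩ := exists_weight (X := b * y) (Y := (m + k : ℕ) * y)
    (N := (b + m : ℕ) * y) (ε := b * y - a * Real.pi) (η := c * Real.pi - d * y)
    (σ := k * y - l * Real.pi) (a := a) (c := c) (l := l) (by push_cast; ring)
    (by rw [hkR']; push_cast; ring) (by push_cast; ring) (by linarith) (by linarith) hεσ hση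
  obtain ⟨v, hv, hchar⟩ := charpoly_muOf_mul_strings (k := k) hb (by omega) ht0 ht1 ht
  refine torusDomain_ne_univ (by omega) hv (fun i => ?_) hchar fun hinj => ?_
  · rw [← circ_nat_mul, circ_mul_star]
  -- Position k of the first string and position b, the start of the second, both carry the exponent
  -- k; here k < b, so the strings overlap.
  · have := hinj (a₁ := ⟨k, by omega⟩) (a₂ := ⟨b, by omega⟩) (by simp [stringExp, hkb])
    rw [Fin.mk.injEq] at this
    omega

end CompactRS

end

theorem proposition1p1 (n : ℕ) (hn : 2 ≤ n) :
    (∀ y : ℝ, 0 ≤ y → y ≤ Real.pi →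
      (¬ CompactRS.IsAdmissible n y ↔ y / Real.pi ∈ CompactRS.farey n) ∧
      ((∃ m : ℕ, 1 ≤ m ∧ m ≤ n ∧ Complex.exp (2 * (m : ℂ) * Complex.I * (y : ℂ)) = 1) ↔
        y / Real.pi ∈ CompactRS.farey n)) ∧
    (∀ κ : ℕ, 1 ≤ κ → κ ≤ n - 1 → Nat.Coprime κ n →
      ∃ p q : ℝ,
        CompactRS.FareyNeighbours n p ((κ : ℝ) / (n : ℝ)) ∧
        CompactRS.FareyNeighbours n ((κ : ℝ) / (n : ℝ)) q ∧
        CompactRS.IntervalTypeI n p ((κ : ℝ) / (n : ℝ)) ∧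
        CompactRS.IntervalTypeI n ((κ : ℝ) / (n : ℝ)) q) ∧
    (∀ p q : ℝ, CompactRS.FareyNeighbours n p q →
      ¬ CompactRS.IsSpecial n p → ¬ CompactRS.IsSpecial n q →
      CompactRS.IntervalTypeII n p q) := by
  refine ⟨fun y h0 h1 => ⟨?_, ?_⟩, fun κ _ hκn hcop => CompactRS.exists_neighbours_typeI hn hκn hcop,
    fun p q h hp hq => CompactRS.intervalTypeII_of_not_isSpecial hn h hp hq⟩
  · rw [CompactRS.not_isAdmissible_iff hn, CompactRS.exists_pow_eq_one_iff h0 h1]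
  · rw [← CompactRS.exists_pow_eq_one_iff h0 h1]
    refine exists_congr fun m => and_congr_right fun _ => and_congr_right fun _ => ?_
    rw [← CompactRS.circ_nat_mul, CompactRS.circ]
    push_cast
    ring_nf
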